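/- Let $n\ge 2$ be even, let $\Omega\subset\mathbb R^n$ be an open set (for instance a convex domain with smooth boundary), let $f\in C_c^\infty(\Omega)$, $x\in\partial\Omega$ and $v\in\mathbb R^n$. Let $u\colon\mathbb R^n\times[0,\infty)\to\mathbb R$ be the classical solution ($C^2$ on $\mathbb R^n\times(0,\infty)$ and $C^1$ on $\mathbb R^n\times[0,\infty)$) of the wave equation $\partial_t^2u-\Delta u=0$ on $\mathbb R^n\times(0,\infty)$ with $u(\cdot,0)=f$ and $\partial_tu(\cdot,0)=0$. Write $$\mathcal Mf(x,r)=\frac1{n\omega_n}\int_{\mathbb S^{n-1}}f(x+ry)\,d\sigma(y)$$ for the spherical means of $f$, where $\omega_n$ is the volume of the unit ball and $\sigma$ the surface measure on the unit sphere $\mathbb S^{n-1}$; let $D_v$ be the directional derivative along $v$ in the spatial variable, and put $\gamma_n=2\cdot4\cdots(n-2)\cdot n$. Operators act on everything to their right; $\partial_tt^{-1}$ is the operator $h\mapsto\partial_t(t^{-1}h(t))$. Then $\mathcal Mf(\cdot,r)$ and $u(\cdot,t)$ are differentiable at $x$ along $v$ for all $r,t>0$, the functions $\mathcal Mf(x,\cdot)$,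 $D_v\mathcal Mf(x,\cdot)$, $u(x,\cdot)$ and $D_vu(x,\cdot)$ are smooth on $(0,\infty)$, and for every $r>0$ the integrals below converge absolutely and $$\Bigl(\frac1r\partial_r\Bigr)^{\frac{n-2}2}r^{n-2}\mathcal Mf(x,r)=\frac{2\gamma_n}{\pi n}\int_0^r\frac{u(x,t)}{\sqrt{r^2-t^2}}\,dt,$$ $$\Bigl(\frac1r\partial_r\Bigr)^{\frac{n-2}2}r^{n-2}D_v\mathcal Mf(x,r)=\frac{2\gamma_n}{\pi n}\int_0^r\frac{D_vu(x,t)}{\sqrt{r^2-t^2}}\,dt,$$ $$\Bigl(\frac1r\partial_r\Bigr)^{n-2}r^{n-2}\mathcal Mf(x,r)=\frac{2\gamma_n}{\pi n}\int_0^r\frac{(\partial_tt^{-1})^{\frac{n-2}2}u(x,t)}{\sqrt{r^2-t^2}}\,dt,$$ $$\Bigl(\frac1r\partial_r\Bigr)^{n-2}r^{n-2}D_v\mathcal Mf(x,r)=\frac{2\gamma_n}{\pi n}\int_0^r\frac{(\partial_tt^{-1})^{\frac{n-2}2}D_vu(x,t)}{\sqrt{r^2-t^2}}\,dt.$$ 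-/

import Mathlib

open MeasureTheory Set
open scoped ContDiff Laplacian Nat

noncomputable section

namespace WaveAbel

/-- The spherical mean `(n ω_n)⁻¹ ∫_{S^{n-1}} f (x + r y) dσ(y)`, where `ω_n` is the volume of the
unit ball and `σ` the (unnormalised) surface measure of the unit sphere. -/
def sphericalMean {n : ℕ} (f : EuclideanSpace ℝ (Fin n) → ℝ) (x : EuclideanSpace ℝ (Fin n))
    (r : ℝ) : ℝ :=
  ((n : ℝ) * volume.real (Metric.ball (0 : EuclideanSpace ℝ (Fin n)) 1))⁻¹ *
    ∫ y : Metric.sphere (0 : EuclideanSpace ℝ (Fin n)) 1, f (x + r • (y : EuclideanSpace ℝ (Fin n)))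
      ∂((volume : Measure (EuclideanSpace ℝ (Fin n))).toSphere)

/-- The directional derivative `D_v F(x,t)` in the spatial variable of a function of `(x,t)`. -/
def spatialDeriv {n : ℕ} (v : EuclideanSpace ℝ (Fin n))
    (F : EuclideanSpace ℝ (Fin n) → ℝ → ℝ) (x : EuclideanSpace ℝ (Fin n)) (t : ℝ) : ℝ :=
  lineDeriv ℝ (fun y => F y t) x v

/-- The operator `r⁻¹ ∂_r`. -/
def invMulDeriv (h : ℝ → ℝ) (r : ℝ) : ℝ := r⁻¹ * deriv h r

/-- The operator `∂_t t⁻¹`, that is, `h ↦ ∂_t (t⁻¹ h(t))`. -/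
def derivInvMul (h : ℝ → ℝ) (t : ℝ) : ℝ := deriv (fun s => s⁻¹ * h s) t

/-- `u` is a classical solution on `ℝⁿ × [0,∞)` of the wave equation `∂_t² u = Δ u` with initial
data `(f,g)`. Values of `u` at negative times play no role. -/
structure IsWaveSolution {n : ℕ} (f g : EuclideanSpace ℝ (Fin n) → ℝ)
    (u : EuclideanSpace ℝ (Fin n) → ℝ → ℝ) : Prop where
  contDiffOn_two : ContDiffOn ℝ 2 (fun p : EuclideanSpace ℝ (Fin n) × ℝ => u p.1 p.2)
    (univ ×ˢ Ioi (0 : ℝ))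
  contDiffOn_one : ContDiffOn ℝ 1 (fun p : EuclideanSpace ℝ (Fin n) × ℝ => u p.1 p.2)
    (univ ×ˢ Ici (0 : ℝ))
  wave_eq : ∀ x, ∀ t, 0 < t → iteratedDeriv 2 (u x) t - Δ (fun y => u y t) x = 0
  initial_value : ∀ x, u x 0 = f x
  initial_velocity : ∀ x, derivWithin (u x) (Ici 0) 0 = g x

end WaveAbel

end

namespace WaveAbel

open Real

/-! Write `n = 2 * m + 2` and let `h` be the time profile of the wave at `x`, extended evenly to
negative times. Everything rests on one averaging formula: up to the normalising factor `(∫ cos ^ (2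
* m))⁻¹`, the spherical mean at radius `r` is `∫ h (r sin θ) cos θ ^ (2 * m)` over `[0, π/2]`. On
the Fourier side this says that the transform of the sphere measure is an average of `cos (|ξ| sin
θ)` with weight `cos θ ^ (2 * m)`, while a wave with zero initial velocity multiplies the amplitude
at `ξ` by `cos (2πt|ξ|)`. The two transforms are matched moment by moment
(`sphereMoment_mul_sinMoment`), which yields `exists_smooth_wave`.

Multiplied by `r ^ (2 * m)`, the average is `abelMean m h`. Each application of `r⁻¹ ∂_r` lowers `m`
by one and produces an odd factor (`invMulDeriv_abelMean_succ`). After `m` steps only `abelMean 0 h`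
is left, which the substitution `t = r sin θ` turns into the Abel integral with kernel `1 / √(r² -
t²)`. Each further `r⁻¹ ∂_r` passes inside as `∂_t t⁻¹` (`invMulDeriv_abelMean_zero`), provided that
`h` vanishes near `0`.

That proviso comes from finite propagation speed: a boundary point of the open set `Ω` lies off the
support of `f`. The energy estimate behind `eq_zero_in_lightCone` supplies it, and it also gives
uniqueness, so that the arbitrary classical solution `u` coincides with the Fourier solution and
inherits its smoothness. The statements for `D_v` follow by running the same argument with the
spatial derivative of the wave as profile. -/

/-! ### Abel averages and their behaviour under `r⁻¹ ∂_r`. -/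

/-- Differentiation under the integral sign for `r ↦ ∫ h (r sin θ) w(θ) dθ`. -/
theorem hasDerivAt_integral_comp_mul_sin {h w : ℝ → ℝ} (hh : ContDiff ℝ ∞ h) (hw : Continuous w)
    (a b r : ℝ) :
    HasDerivAt (fun r => ∫ θ in a..b, h (r * sin θ) * w θ)
      (∫ θ in a..b, deriv h (r * sin θ) * (sin θ * w θ)) r := by
  have hd : Continuous (deriv h) := hh.continuous_deriv (by simp)
  have hc : Continuous (fun p : ℝ × ℝ => deriv h (p.1 * sin p.2) * (sin p.2 * w p.2)) := by fun_prop
  obtain ⟨C, hC⟩ := ((isCompact_closedBall r (1 : ℝ)).prod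
    (isCompact_uIcc (a := a) (b := b))).exists_bound_of_continuousOn hc.continuousOn
  refine (intervalIntegral.hasDerivAt_integral_of_dominated_loc_of_deriv_le
    (F := fun r θ => h (r * sin θ) * w θ) (bound := fun _ => C)
    (F' := fun r θ => deriv h (r * sin θ) * (sin θ * w θ))
    (Metric.ball_mem_nhds r one_pos) (Filter.Eventually.of_forall fun s => ?_) ?_ ?_ ?_ ?_ ?_).2
  · exact Continuous.aestronglyMeasurable (by have := hh.continuous; fun_prop)
  · exact Continuous.intervalIntegrable (by have := hh.continuous; fun_prop) _ _
  · exact Continuous.aestronglyMeasurable (by fun_prop)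
  · refine Filter.Eventually.of_forall fun θ hθ s hs => ?_
    exact hC (s, θ) ⟨Metric.ball_subset_closedBall hs, uIoc_subset_uIcc hθ⟩
  · exact intervalIntegrable_const
  · refine Filter.Eventually.of_forall fun θ _ s _ => ?_
    have h1 : HasDerivAt (fun s => s * sin θ) (sin θ) s := by
      simpa using (hasDerivAt_id s).mul_const (sin θ)
    have h2 := ((hh.differentiable (by simp)).differentiableAt (x := s * sin θ)).hasDerivAt
    have h3 := (h2.comp s h1).mul_const (w θ)
    simpa [mul_assoc] using h3

theorem contDiff_integral_comp_mul_sin {h w : ℝ → ℝ} (hh : ContDiff ℝ ∞ h) (hw : Continuous w)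
    (a b : ℝ) : ContDiff ℝ ∞ (fun r => ∫ θ in a..b, h (r * sin θ) * w θ) := by
  refine contDiff_infty.2 fun k => ?_
  induction k generalizing h w with
  | zero =>
    refine contDiff_zero.2 (continuous_iff_continuousAt.2 fun r => ?_)
    exact (hasDerivAt_integral_comp_mul_sin hh hw a b r).continuousAt
  | succ k ih =>
    refine (contDiff_succ_iff_deriv (n := k)).2
      ⟨fun r => (hasDerivAt_integral_comp_mul_sin hh hw a b r).differentiableAt, by simp, ?_⟩
    have : deriv (fun r => ∫ θ in a..b, h (r * sin θ) * w θ) =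
        fun r => ∫ θ in a..b, deriv h (r * sin θ) * (sin θ * w θ) :=
      funext fun r => (hasDerivAt_integral_comp_mul_sin hh hw a b r).deriv
    rw [this]
    exact ih (contDiff_infty_iff_deriv.1 hh).2 (by fun_prop)

/-- The Abel-type average `r^{2m} ∫₀^{π/2} h(r sin θ) cos^{2m} θ dθ`. -/
noncomputable def abelMean (m : ℕ) (h : ℝ → ℝ) (r : ℝ) : ℝ :=
  r ^ (2 * m) * ∫ θ in (0 : ℝ)..(π / 2), h (r * sin θ) * cos θ ^ (2 * m)

/-- The difference of the two sides is the integral of the total `θ`-derivative of `h (r sin θ) sin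
θ cos θ ^ (2m+1)`, whose boundary values vanish because `sin 0 = 0` and `cos (π/2) = 0`. -/
theorem invMulDeriv_abelMean_succ {h : ℝ → ℝ} (hh : ContDiff ℝ ∞ h) (m : ℕ) {r : ℝ} (hr : 0 < r) :
    invMulDeriv (abelMean (m + 1) h) r = (2 * m + 1) * abelMean m h r := by
  have hd : Continuous (deriv h) := hh.continuous_deriv (by simp)
  have hc := hh.continuous
  have h1 := (hasDerivAt_pow (2 * (m + 1)) r).mul (hasDerivAt_integral_comp_mul_sin hh
    (w := fun θ => cos θ ^ (2 * (m + 1))) (by fun_prop) 0 (π / 2) r)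
  have h2 : deriv (abelMean (m + 1) h) r = _ := h1.deriv
  have h3 : ∫ θ in (0 : ℝ)..(π / 2), ((r * (deriv h (r * sin θ) * (sin θ * cos θ ^ (2 * (m + 1))))
      + (2 * m + 2) * (h (r * sin θ) * cos θ ^ (2 * (m + 1))))
      - (2 * m + 1) * (h (r * sin θ) * cos θ ^ (2 * m))) = 0 := by
    rw [intervalIntegral.integral_eq_sub_of_hasDerivAt
      (f := fun θ => h (r * sin θ) * (sin θ * cos θ ^ (2 * m + 1)))]
    · simp
    · intro θ _
      have e1 : HasDerivAt (fun θ => r * sin θ) (r * cos θ) θ := (hasDerivAt_sin θ).const_mul r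
      have e2 := ((hh.differentiable (by simp)).differentiableAt (x := r * sin θ)).hasDerivAt
      have e3 := (e2.comp θ e1).mul ((hasDerivAt_sin θ).mul ((hasDerivAt_cos θ).pow (2 * m + 1)))
      refine e3.congr_deriv ?_
      have hs : sin θ ^ 2 = 1 - cos θ ^ 2 := by rw [← sin_sq_add_cos_sq θ]; ring
      simp only [Function.comp, Nat.add_sub_cancel, Pi.pow_apply, Pi.mul_apply]
      push_cast
      linear_combination (-(2 * m + 1) * h (r * sin θ) * cos θ ^ (2 * m)) * hs
    · exact Continuous.intervalIntegrable (by fun_prop) _ _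
  rw [intervalIntegral.integral_sub, intervalIntegral.integral_add,
    intervalIntegral.integral_const_mul, intervalIntegral.integral_const_mul,
    intervalIntegral.integral_const_mul] at h3
  · rw [invMulDeriv, h2, abelMean]
    push_cast
    simp only [show 2 * (m + 1) - 1 = 2 * m + 1 from rfl]
    rw [inv_mul_eq_iff_eq_mul₀ hr.ne']
    simp only [show 2 * (m + 1) = 2 * m + 2 from rfl] at h3 ⊢
    linear_combination (r ^ (2 * m + 1)) * h3
  all_goals exact Continuous.intervalIntegrable (by fun_prop) _ _

/-- The identities hold only for positive arguments. Since `Ioi 0` is open, agreement there survives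
differentiation and hence iteration. -/
theorem invMulDeriv_congr {g h : ℝ → ℝ} (hgh : EqOn g h (Ioi 0)) :
    EqOn (invMulDeriv g) (invMulDeriv h) (Ioi 0) := fun r hr => by
  have : g =ᶠ[nhds r] h := Filter.eventuallyEq_of_mem (Ioi_mem_nhds hr) hgh
  simp [invMulDeriv, this.deriv_eq]

theorem derivInvMul_congr {g h : ℝ → ℝ} (hgh : EqOn g h (Ioi 0)) :
    EqOn (derivInvMul g) (derivInvMul h) (Ioi 0) := fun r hr => by
  have : (fun s => s⁻¹ * g s) =ᶠ[nhds r] (fun s => s⁻¹ * h s) :=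
    Filter.eventuallyEq_of_mem (Ioi_mem_nhds hr) fun s hs => by simp [hgh hs]
  exact this.deriv_eq

theorem iterate_invMulDeriv_congr {g h : ℝ → ℝ} (hgh : EqOn g h (Ioi 0)) (k : ℕ) :
    EqOn (invMulDeriv^[k] g) (invMulDeriv^[k] h) (Ioi 0) := by
  induction k generalizing g h with
  | zero => exact hgh
  | succ k ih => exact ih (invMulDeriv_congr hgh)

theorem iterate_derivInvMul_congr {g h : ℝ → ℝ} (hgh : EqOn g h (Ioi 0)) (k : ℕ) :
    EqOn (derivInvMul^[k] g) (derivInvMul^[k] h) (Ioi 0) := by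
  induction k generalizing g h with
  | zero => exact hgh
  | succ k ih => exact ih (derivInvMul_congr hgh)

theorem iterate_invMulDeriv_const_mul (c : ℝ) (g : ℝ → ℝ) (k : ℕ) :
    invMulDeriv^[k] (fun s => c * g s) = fun s => c * (invMulDeriv^[k] g) s := by
  induction k generalizing g with
  | zero => rfl
  | succ k ih =>
    have : invMulDeriv (fun s => c * g s) = fun s => c * invMulDeriv g s := by
      funext s
      simp only [invMulDeriv, deriv_const_mul_field]
      ring
    rw [Function.iterate_succ_apply, this, ih, Function.iterate_succ_apply]

theorem iterate_invMulDeriv_abelMean {h : ℝ → ℝ} (hh : ContDiff ℝ ∞ h) (m : ℕ) :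
    EqOn (invMulDeriv^[m] (abelMean m h)) (fun r => ((2 * m - 1)‼ : ℕ) * abelMean 0 h r)
      (Ioi 0) := by
  induction m with
  -- Truncated subtraction gives `2 * 0 - 1 = 0`, and `0‼ = 1` is the right empty product.
  | zero => intro r _; simp
  | succ m ih =>
    intro r hr
    rw [Function.iterate_succ_apply, iterate_invMulDeriv_congr
      (fun s hs => invMulDeriv_abelMean_succ hh m hs) m hr, iterate_invMulDeriv_const_mul]
    simp only [ih hr]
    rw [show 2 * (m + 1) - 1 = 2 * m + 1 by omega, Nat.doubleFactorial_add_one]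
    push_cast
    ring

/-- Division by the variable preserves smoothness of functions that vanish near the origin. -/
theorem contDiff_inv_mul {h : ℝ → ℝ} (hh : ContDiff ℝ ∞ h) (h0 : h =ᶠ[nhds 0] 0) :
    ContDiff ℝ ∞ (fun s => s⁻¹ * h s) := by
  refine contDiff_iff_contDiffAt.2 fun s => ?_
  rcases eq_or_ne s 0 with rfl | hs
  · refine (contDiffAt_const (c := (0 : ℝ))).congr_of_eventuallyEq ?_
    filter_upwards [h0] with s hs
    simp [hs]
  · exact (contDiffAt_inv ℝ hs).mul hh.contDiffAt

theorem contDiff_derivInvMul {h : ℝ → ℝ} (hh : ContDiff ℝ ∞ h) (h0 : h =ᶠ[nhds 0] 0) :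
    ContDiff ℝ ∞ (derivInvMul h) :=
  (contDiff_infty_iff_deriv.1 (contDiff_inv_mul hh h0)).2

theorem derivInvMul_eventuallyEq_zero {h : ℝ → ℝ} (h0 : h =ᶠ[nhds 0] 0) :
    derivInvMul h =ᶠ[nhds 0] 0 := by
  have : (fun s => s⁻¹ * h s) =ᶠ[nhds 0] fun _ => 0 := by
    filter_upwards [h0] with s hs
    simp [hs]
  filter_upwards [this.eventuallyEq_nhds] with s hs
  simp [derivInvMul, hs.deriv_eq]

/-- With `k = h / s`, one has `h' = k + s k'`, and `r k' (r sin θ) - h' (r sin θ) sin θ` is the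
`θ`-derivative of `cos θ k (r sin θ)`. This vanishes at `π/2` because of the cosine and at `0`
because `k 0 = 0`. -/
theorem invMulDeriv_abelMean_zero {h : ℝ → ℝ} (hh : ContDiff ℝ ∞ h) (h0 : h =ᶠ[nhds 0] 0)
    {r : ℝ} (hr : 0 < r) :
    invMulDeriv (abelMean 0 h) r = abelMean 0 (derivInvMul h) r := by
  set k : ℝ → ℝ := fun s => s⁻¹ * h s with hk
  have hkd : ContDiff ℝ ∞ k := contDiff_inv_mul hh h0
  have hkd' : Continuous (deriv k) := hkd.continuous_deriv (by simp)
  have hkc := hkd.continuous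
  have hd : Continuous (deriv h) := hh.continuous_deriv (by simp)
  have hhk : h = fun s => s * k s := by
    funext s
    rcases eq_or_ne s 0 with rfl | hs
    · simpa using h0.self_of_nhds
    · simp [hk, hs]
  have hdh : ∀ s, deriv h s = k s + s * deriv k s := fun s => by
    have := ((hasDerivAt_id s).mul
      ((hkd.differentiable (by simp)).differentiableAt (x := s)).hasDerivAt).deriv
    simp only [one_mul, id] at this
    rw [← this, hhk]
    rfl
  have h2 : deriv (abelMean 0 h) r =
      ∫ θ in (0 : ℝ)..(π / 2), deriv h (r * sin θ) * (sin θ * cos θ ^ (2 * 0)) := by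
    rw [← (hasDerivAt_integral_comp_mul_sin hh (w := fun θ => cos θ ^ (2 * 0)) (by fun_prop)
      0 (π / 2) r).deriv]
    congr 1
    funext r
    simp [abelMean]
  have h3 : ∫ θ in (0 : ℝ)..(π / 2), (r * deriv k (r * sin θ) -
      deriv h (r * sin θ) * (sin θ * cos θ ^ (2 * 0))) = 0 := by
    rw [intervalIntegral.integral_eq_sub_of_hasDerivAt (f := fun θ => cos θ * k (r * sin θ))]
    · simp [hk]
    · intro θ _
      have e1 : HasDerivAt (fun θ => r * sin θ) (r * cos θ) θ := (hasDerivAt_sin θ).const_mul r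
      have e2 := ((hkd.differentiable (by simp)).differentiableAt (x := r * sin θ)).hasDerivAt
      refine ((hasDerivAt_cos θ).mul (e2.comp θ e1)).congr_deriv ?_
      have hs : sin θ ^ 2 = 1 - cos θ ^ 2 := by rw [← sin_sq_add_cos_sq θ]; ring
      simp only [Function.comp, hdh]
      linear_combination (r * deriv k (r * sin θ)) * hs
    · exact Continuous.intervalIntegrable (by fun_prop) _ _
  rw [intervalIntegral.integral_sub, intervalIntegral.integral_const_mul, ← h2] at h3
  · have : derivInvMul h = deriv k := rfl
    simp only [invMulDeriv, this, abelMean, mul_zero, pow_zero, mul_one, one_mul]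
    have hr' := hr.ne'
    field_simp
    linear_combination -h3
  all_goals exact Continuous.intervalIntegrable (by fun_prop) _ _

theorem contDiff_iterate_derivInvMul {h : ℝ → ℝ} (hh : ContDiff ℝ ∞ h) (h0 : h =ᶠ[nhds 0] 0)
    (k : ℕ) : ContDiff ℝ ∞ (derivInvMul^[k] h) := by
  induction k generalizing h with
  | zero => exact hh
  | succ k ih => exact ih (contDiff_derivInvMul hh h0) (derivInvMul_eventuallyEq_zero h0)

theorem iterate_invMulDeriv_abelMean_zero {h : ℝ → ℝ} (hh : ContDiff ℝ ∞ h)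
    (h0 : h =ᶠ[nhds 0] 0) (k : ℕ) :
    EqOn (invMulDeriv^[k] (abelMean 0 h)) (abelMean 0 (derivInvMul^[k] h)) (Ioi 0) := by
  induction k generalizing h with
  | zero => intro r _; rfl
  | succ k ih =>
    intro r hr
    rw [Function.iterate_succ_apply, iterate_invMulDeriv_congr
      (fun s hs => invMulDeriv_abelMean_zero hh h0 hs) k hr,
      ih (contDiff_derivInvMul hh h0) (derivInvMul_eventuallyEq_zero h0) hr,
      Function.iterate_succ_apply]

theorem image_mul_sin_Ioo {r : ℝ} (hr : 0 < r) :
    (fun θ => r * sin θ) '' Ioo 0 (π / 2) = Ioo 0 r := by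
  ext t
  constructor
  · rintro ⟨θ, ⟨h1, h2⟩, rfl⟩
    have hs : 0 < sin θ := sin_pos_of_pos_of_lt_pi h1 (by linarith [pi_pos])
    have hc : sin θ < 1 := by
      rw [← sin_pi_div_two]
      exact sin_lt_sin_of_lt_of_le_pi_div_two (by linarith) le_rfl h2
    exact ⟨by positivity, by nlinarith⟩
  · rintro ⟨h1, h2⟩
    have h3 : t / r < 1 := (div_lt_one hr).2 h2
    have h4 : 0 < t / r := by positivity
    refine ⟨arcsin (t / r), ⟨arcsin_pos.2 h4, arcsin_lt_pi_div_two.2 h3⟩, ?_⟩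
    simp only [sin_arcsin (by linarith) h3.le]
    field_simp

/-- The substitution `t = r sin θ`, with convergence of the singular integral. -/
theorem integral_div_sqrt_eq_abelMean {h : ℝ → ℝ} (hh : Continuous h) {r : ℝ} (hr : 0 < r) :
    IntervalIntegrable (fun t => h t / √(r ^ 2 - t ^ 2)) volume 0 r ∧
      ∫ t in (0 : ℝ)..r, h t / √(r ^ 2 - t ^ 2) = abelMean 0 h r := by
  have hder : ∀ θ ∈ Ioo (0 : ℝ) (π / 2),
      HasDerivWithinAt (fun θ => r * sin θ) (r * cos θ) (Ioo 0 (π / 2)) θ := fun θ _ =>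
    ((hasDerivAt_sin θ).const_mul r).hasDerivWithinAt
  have hinj : InjOn (fun θ => r * sin θ) (Ioo 0 (π / 2)) := by
    intro a ha b hb hab
    exact injOn_sin ⟨by linarith [ha.1, pi_pos], ha.2.le⟩ ⟨by linarith [hb.1, pi_pos], hb.2.le⟩
      (mul_left_cancel₀ hr.ne' hab)
  have hcongr : EqOn (fun θ => |r * cos θ| • (h (r * sin θ) / √(r ^ 2 - (r * sin θ) ^ 2)))
      (fun θ => h (r * sin θ)) (Ioo 0 (π / 2)) := by
    intro θ hθ
    have hc : 0 < cos θ := cos_pos_of_mem_Ioo ⟨by linarith [hθ.1, pi_pos], hθ.2⟩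
    have hs : r ^ 2 - (r * sin θ) ^ 2 = (r * cos θ) ^ 2 := by
      linear_combination -(r ^ 2) * sin_sq_add_cos_sq θ
    have hp : 0 < r * cos θ := by positivity
    simp only [hs, sqrt_sq hp.le, abs_of_pos hp, smul_eq_mul]
    field_simp
  have hint : IntegrableOn (fun θ => h (r * sin θ)) (Ioo 0 (π / 2)) :=
    ((Continuous.integrableOn_Icc (by fun_prop)).mono_set Ioo_subset_Icc_self)
  have key := integrableOn_image_iff_integrableOn_abs_deriv_smul measurableSet_Ioo hder hinj
    (fun t => h t / √(r ^ 2 - t ^ 2))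
  have key2 := integral_image_eq_integral_abs_deriv_smul measurableSet_Ioo hder hinj
    (fun t => h t / √(r ^ 2 - t ^ 2))
  rw [image_mul_sin_Ioo hr] at key key2
  constructor
  · rw [intervalIntegrable_iff_integrableOn_Ioo_of_le hr.le, key]
    exact hint.congr_fun hcongr.symm measurableSet_Ioo
  · rw [intervalIntegral.integral_of_le hr.le, integral_Ioc_eq_integral_Ioo, key2,
      setIntegral_congr_fun measurableSet_Ioo hcongr, abelMean,
      intervalIntegral.integral_of_le (by positivity), integral_Ioc_eq_integral_Ioo]
    simp

/-- Wallis' formula, obtained from the Abel recursion with the constant profile `1` at `r = 1`. -/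
theorem integral_cos_pow_even_mul (m : ℕ) :
    (∫ θ in (0 : ℝ)..(π / 2), cos θ ^ (2 * m)) * ((2 * m)‼ : ℕ) = π / 2 * ((2 * m - 1)‼ : ℕ) := by
  induction m with
  | zero => simp
  | succ m ih =>
    have h1 := invMulDeriv_abelMean_succ (h := fun _ => 1) contDiff_const m (r := 1) one_pos
    have h2 : abelMean (m + 1) (fun _ => 1) =
        fun r => r ^ (2 * (m + 1)) * ∫ θ in (0 : ℝ)..(π / 2), cos θ ^ (2 * (m + 1)) := by
      funext r; simp [abelMean]
    rw [h2] at h1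
    simp only [invMulDeriv, deriv_mul_const_field, abelMean] at h1
    simp at h1
    rw [show 2 * (m + 1) - 1 = 2 * m + 1 by omega, Nat.doubleFactorial_add_one,
      show 2 * (m + 1) = 2 * m + 2 by ring, Nat.doubleFactorial_add_two]
    push_cast
    simp only [show 2 * (m + 1) = 2 * m + 2 by ring] at h1
    linear_combination ((2 * m)‼ : ℝ) * h1 + (2 * m + 1 : ℝ) * ih

/-! ### Moments and Fourier transform of the sphere measure. -/

section Sphere

variable {V : Type*} [NormedAddCommGroup V] [InnerProductSpace ℝ V] [FiniteDimensional ℝ V]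
  [MeasurableSpace V] [BorelSpace V]

/-- The radial Gaussian moments. -/
noncomputable def radialMoment (k : ℕ) : ℝ := ∫ r in Ioi (0 : ℝ), r ^ k * exp (-r ^ 2)

theorem radialMoment_eq (k : ℕ) : radialMoment k = 1 / 2 * Gamma ((k + 1) / 2) := by
  have := integral_rpow_mul_exp_neg_rpow (p := 2) (q := k) (by norm_num)
    (by have : (0 : ℝ) ≤ k := k.cast_nonneg
        linarith)
  rw [← this, radialMoment]
  simp

theorem radialMoment_pos (k : ℕ) : 0 < radialMoment k := by
  rw [radialMoment_eq]
  have := Gamma_pos_of_pos (s := ((k : ℝ) + 1) / 2) (by positivity)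
  positivity

theorem radialMoment_add_two (k : ℕ) : 2 * radialMoment (k + 2) = (k + 1) * radialMoment k := by
  rw [radialMoment_eq, radialMoment_eq]
  push_cast
  rw [show ((k : ℝ) + 2 + 1) / 2 = (k + 1) / 2 + 1 by ring, Gamma_add_one (by positivity)]
  ring

/-- A Bochner integral with nonzero value can only come from an integrable function. -/
theorem integrableOn_pow_mul_exp_neg_sq (k : ℕ) :
    IntegrableOn (fun r : ℝ => r ^ k * exp (-r ^ 2)) (Ioi 0) :=
  not_imp_comm.1 integral_undef (radialMoment_pos k).ne'

theorem integrable_inner_pow_mul_exp_neg_norm_sq [Nontrivial V] (w : V) (k : ℕ) :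
    Integrable (fun x : V => inner ℝ x w ^ k * exp (-‖x‖ ^ 2)) := by
  have h1 : Integrable (fun x : V => ‖w‖ ^ k * (‖x‖ ^ k * exp (-‖x‖ ^ 2))) := by
    refine Integrable.const_mul ?_ _
    rw [integrable_fun_norm_addHaar volume (f := fun r => r ^ k * exp (-r ^ 2))]
    refine (integrableOn_pow_mul_exp_neg_sq (Module.finrank ℝ V - 1 + k)).congr_fun
      (fun r _ => ?_) measurableSet_Ioi
    simp only [smul_eq_mul]
    ring
  refine h1.mono' (Continuous.aestronglyMeasurable (by fun_prop)) (Filter.Eventually.of_forall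
    fun x => ?_)
  rw [norm_mul, norm_pow, norm_of_nonneg (exp_nonneg _), ← mul_assoc, ← mul_pow, mul_comm ‖w‖]
  gcongr
  exact norm_inner_le_norm x w

/-- Integration by parts along `w`, using that the Gaussian has derivative `-2⟨x, w⟩` times itself.
For `j = 0` the truncated exponent `j - 1` is harmless, since the factor `j` kills the right-hand
side. -/
theorem integral_inner_pow_mul_exp_succ [Nontrivial V] (w : V) (j : ℕ) :
    2 * ∫ x : V, inner ℝ x w ^ (j + 1) * exp (-‖x‖ ^ 2) =
      j * ‖w‖ ^ 2 * ∫ x : V, inner ℝ x w ^ (j - 1) * exp (-‖x‖ ^ 2) := by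
  have hf : ∀ x : V, HasFDerivAt (fun x : V => inner ℝ x w ^ j)
      ((j * inner ℝ x w ^ (j - 1)) • (innerSL ℝ w)) x := fun x => by
    have := ((innerSL ℝ w).hasFDerivAt (x := x)).pow j
    simpa [real_inner_comm] using this
  have hg : ∀ x : V, HasFDerivAt (fun x : V => exp (-‖x‖ ^ 2))
      (exp (-‖x‖ ^ 2) • (-((2 : ℕ) • innerSL ℝ x) : V →L[ℝ] ℝ)) x := fun x =>
    ((hasStrictFDerivAt_norm_sq x).hasFDerivAt.neg).exp
  have key := integral_mul_fderiv_eq_neg_fderiv_mul_of_integrable (μ := (volume : Measure V))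
    (f := fun x : V => inner ℝ x w ^ j) (g := fun x : V => exp (-‖x‖ ^ 2)) (v := w)
    ?_ ?_ (integrable_inner_pow_mul_exp_neg_norm_sq w j)
    (fun x _ => (hf x).differentiableAt) (fun x _ => (hg x).differentiableAt)
  · have e1 : (fun x : V => inner ℝ x w ^ j * fderiv ℝ (fun x : V => exp (-‖x‖ ^ 2)) x w) =
        fun x => (-2) * (inner ℝ x w ^ (j + 1) * exp (-‖x‖ ^ 2)) := by
      funext x
      simp [(hg x).fderiv]
      ring
    have e2 : (fun x : V => fderiv ℝ (fun x : V => inner ℝ x w ^ j) x w * exp (-‖x‖ ^ 2)) =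
        fun x => (j * ‖w‖ ^ 2) * (inner ℝ x w ^ (j - 1) * exp (-‖x‖ ^ 2)) := by
      funext x
      simp [(hf x).fderiv]
      ring
    rw [e1, e2, integral_const_mul, integral_const_mul] at key
    linarith
  · refine ((integrable_inner_pow_mul_exp_neg_norm_sq w (j - 1)).const_mul (j * ‖w‖ ^ 2)).congr
      (Filter.Eventually.of_forall fun x => ?_)
    simp [(hf x).fderiv]
    ring
  · refine ((integrable_inner_pow_mul_exp_neg_norm_sq w (j + 1)).const_mul (-2)).congr
      (Filter.Eventually.of_forall fun x => ?_)
    simp [(hg x).fderiv]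
    ring

/-- The moments `∫ ⟨θ, w⟩ ^ k dσ(θ)` of the unit sphere. -/
noncomputable def sphereMoment (w : V) (k : ℕ) : ℝ :=
  ∫ y : Metric.sphere (0 : V) 1, inner ℝ (y : V) w ^ k ∂(volume : Measure V).toSphere

/-- Polar coordinates: the integrand splits into an angular and a radial factor, and the Jacobian
contributes the exponent `finrank - 1`. This carries Gaussian identities over to the sphere. -/
theorem integral_inner_pow_mul_exp_eq [Nontrivial V] (w : V) (k : ℕ) :
    ∫ x : V, inner ℝ x w ^ k * exp (-‖x‖ ^ 2) =
      sphereMoment w k * radialMoment (Module.finrank ℝ V - 1 + k) := by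
  calc ∫ x : V, inner ℝ x w ^ k * exp (-‖x‖ ^ 2)
      = ∫ x : ({(0)}ᶜ : Set V), inner ℝ x.1 w ^ k * exp (-‖x.1‖ ^ 2)
          ∂((volume : Measure V).comap (↑)) := by
        rw [integral_subtype_comap (measurableSet_singleton _).compl
          fun x : V => inner ℝ x w ^ k * exp (-‖x‖ ^ 2), restrict_compl_singleton]
    _ = ∫ p : Metric.sphere (0 : V) 1 × Ioi (0 : ℝ),
          inner ℝ (p.1 : V) w ^ k * ((p.2 : ℝ) ^ k * exp (-(p.2 : ℝ) ^ 2))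
          ∂((volume : Measure V).toSphere.prod (.volumeIoiPow (Module.finrank ℝ V - 1))) := by
        rw [← ((volume : Measure V).measurePreserving_homeomorphUnitSphereProd).integral_comp
          (Homeomorph.measurableEmbedding _)]
        refine integral_congr_ae (Filter.Eventually.of_forall fun x => ?_)
        have hx : ‖(x : V)‖ ≠ 0 := norm_ne_zero_iff.2 x.2
        simp only [homeomorphUnitSphereProd_apply_snd_coe, homeomorphUnitSphereProd_apply_fst_coe,
          inner_smul_left]
        rw [← mul_assoc, ← mul_pow]
        congr 2
        simp
        field_simp
    _ = sphereMoment w k * ∫ r : Ioi (0 : ℝ), (r : ℝ) ^ k * exp (-(r : ℝ) ^ 2)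
          ∂(.volumeIoiPow (Module.finrank ℝ V - 1)) :=
        integral_prod_mul (fun y : Metric.sphere (0 : V) 1 => inner ℝ (y : V) w ^ k)
          (fun r : Ioi (0 : ℝ) => (r : ℝ) ^ k * exp (-(r : ℝ) ^ 2))
    _ = _ := by
      congr 1
      simp only [Measure.volumeIoiPow, ENNReal.ofReal]
      rw [integral_withDensity_eq_integral_smul,
        integral_subtype_comap measurableSet_Ioi fun a : ℝ =>
          Real.toNNReal (a ^ (Module.finrank ℝ V - 1)) • (a ^ k * exp (-a ^ 2)), radialMoment,
        setIntegral_congr_fun measurableSet_Ioi fun x hx => ?_]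
      · rw [NNReal.smul_def, Real.coe_toNNReal _ (pow_nonneg hx.out.le _), smul_eq_mul, pow_add,
          mul_assoc]
      · exact (measurable_subtype_coe.pow_const _).real_toNNReal

theorem sphereMoment_one [Nontrivial V] (w : V) : sphereMoment w 1 = 0 := by
  have h := integral_inner_pow_mul_exp_succ w 0
  rw [integral_inner_pow_mul_exp_eq] at h
  simpa [(radialMoment_pos _).ne'] using h

theorem sphereMoment_add_two [Nontrivial V] (w : V) (k : ℕ) :
    (Module.finrank ℝ V + k) * sphereMoment w (k + 2) = (k + 1) * ‖w‖ ^ 2 * sphereMoment w k := by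
  have h := integral_inner_pow_mul_exp_succ w (k + 1)
  rw [integral_inner_pow_mul_exp_eq, integral_inner_pow_mul_exp_eq] at h
  have hpos : 0 < Module.finrank ℝ V := Module.finrank_pos
  have h2 := radialMoment_add_two (Module.finrank ℝ V - 1 + k)
  push_cast [Nat.cast_sub hpos] at h2 h
  refine mul_right_cancel₀ (radialMoment_pos (Module.finrank ℝ V - 1 + k)).ne' ?_
  simp only [show k + 1 + 1 = k + 2 from rfl, ← add_assoc] at h h2
  linear_combination h - sphereMoment w (k + 2) * h2

/-- The moments `∫ sin^k θ cos^{2m} θ dθ` over `[-π/2, π/2]`. -/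
noncomputable def sinMoment (m k : ℕ) : ℝ :=
  ∫ θ in (-(π / 2))..(π / 2), sin θ ^ k * cos θ ^ (2 * m)

theorem sinMoment_one (m : ℕ) : sinMoment m 1 = 0 := by
  rw [sinMoment, intervalIntegral.integral_eq_sub_of_hasDerivAt
    (f := fun θ => -(cos θ ^ (2 * m + 1)) / (2 * m + 1))]
  · simp
  · intro θ _
    refine (((hasDerivAt_cos θ).pow (2 * m + 1)).neg.div_const (2 * m + 1 : ℝ)).congr_deriv ?_
    have : (2 * m + 1 : ℝ) ≠ 0 := by positivity
    simp only [Nat.add_sub_cancel]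
    push_cast
    field_simp
  · exact Continuous.intervalIntegrable (by fun_prop) _ _

/-- The integral of the derivative of `sin θ ^ (k+1) cos θ ^ (2m+1)` vanishes, because the cosine is
zero at both ends. -/
theorem sinMoment_add_two (m k : ℕ) :
    (2 * m + 2 + k) * sinMoment m (k + 2) = (k + 1) * sinMoment m k := by
  have h3 : ∫ θ in (-(π / 2))..(π / 2), ((k + 1) * (sin θ ^ k * cos θ ^ (2 * m)) -
      (2 * m + 2 + k) * (sin θ ^ (k + 2) * cos θ ^ (2 * m))) = 0 := by
    rw [intervalIntegral.integral_eq_sub_of_hasDerivAt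
      (f := fun θ => sin θ ^ (k + 1) * cos θ ^ (2 * m + 1))]
    · simp
    · intro θ _
      refine (((hasDerivAt_sin θ).pow (k + 1)).mul
        ((hasDerivAt_cos θ).pow (2 * m + 1))).congr_deriv ?_
      have hs : cos θ ^ 2 = 1 - sin θ ^ 2 := by rw [← sin_sq_add_cos_sq θ]; ring
      simp only [Nat.add_sub_cancel, Pi.pow_apply]
      push_cast
      linear_combination ((k + 1) * sin θ ^ k * cos θ ^ (2 * m)) * hs
    · exact Continuous.intervalIntegrable (by fun_prop) _ _
  rw [intervalIntegral.integral_sub, intervalIntegral.integral_const_mul,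
    intervalIntegral.integral_const_mul] at h3
  · simp only [sinMoment]
    linarith
  all_goals exact Continuous.intervalIntegrable (by fun_prop) _ _

/-- Both families satisfy the same two-step recursion exactly when the dimension is `2m + 2`, and
both first moments vanish. -/
theorem sphereMoment_mul_sinMoment {m : ℕ} (hV : Module.finrank ℝ V = 2 * m + 2) (w : V) (k : ℕ) :
    sphereMoment w k * sinMoment m 0 = ‖w‖ ^ k * sinMoment m k * sphereMoment w 0 := by
  have : Nontrivial V := Module.nontrivial_of_finrank_pos (R := ℝ) (by omega)
  induction k using Nat.twoStepInduction with
  | zero => ring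
  | one => simp [sphereMoment_one, sinMoment_one]
  | more k ih _ =>
    have h1 := sphereMoment_add_two w k
    have h2 := sinMoment_add_two m k
    rw [hV] at h1
    push_cast at h1
    have h3 : (2 * m + 2 + k : ℝ) ≠ 0 := by positivity
    refine mul_left_cancel₀ h3 ?_
    linear_combination sinMoment m 0 * h1 + (k + 1) * ‖w‖ ^ 2 * ih -
      ‖w‖ ^ (k + 2) * sphereMoment w 0 * h2

/-- Termwise integration of the exponential series, dominated by `M ^ k / k!`. It reduces equality
of Fourier transforms to equality of moments. -/
theorem hasSum_integral_cexp_mul {α : Type*} [MeasurableSpace α] (μ : Measure α)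
    [IsFiniteMeasure μ] {g c : α → ℝ} {M : ℝ} (hg : AEStronglyMeasurable g μ)
    (hc : AEStronglyMeasurable c μ) (hgM : ∀ a, |g a| ≤ M) (hc1 : ∀ a, |c a| ≤ 1) :
    HasSum (fun k : ℕ => Complex.I ^ k / k ! * ((∫ a, g a ^ k * c a ∂μ : ℝ) : ℂ))
      (∫ a, Complex.exp (Complex.I * g a) * c a ∂μ) := by
  have hF : ∀ (k : ℕ) a, ‖Complex.I ^ k / k ! * ((g a ^ k * c a : ℝ) : ℂ)‖ ≤ M ^ k / k ! := by
    intro k a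
    rw [norm_mul, norm_div, norm_pow, Complex.norm_I, one_pow, Complex.norm_real, norm_mul,
      norm_pow, Complex.norm_natCast, one_div_mul_eq_div]
    gcongr
    calc ‖g a‖ ^ k * ‖c a‖ ≤ M ^ k * 1 := by
          gcongr
          · exact pow_nonneg ((abs_nonneg _).trans (hgM a)) k
          · exact hgM a
          · exact hc1 a
      _ = M ^ k := mul_one _
  have hm : ∀ k : ℕ, AEStronglyMeasurable
      (fun a => Complex.I ^ k / k ! * ((g a ^ k * c a : ℝ) : ℂ)) μ := fun k =>
    (Complex.continuous_ofReal.comp_aestronglyMeasurable ((hg.pow k).mul hc)).const_mul _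
  have key := hasSum_integral_of_summable_integral_norm (μ := μ)
    (F := fun (k : ℕ) a => Complex.I ^ k / k ! * ((g a ^ k * c a : ℝ) : ℂ))
    (fun k => Integrable.of_bound (hm k) _ (Filter.Eventually.of_forall (hF k)))
    (Summable.of_nonneg_of_le (fun k => integral_nonneg fun a => norm_nonneg _)
      (fun k => (integral_mono_of_nonneg (Filter.Eventually.of_forall fun a => norm_nonneg _)
        (integrable_const _) (Filter.Eventually.of_forall (hF k))).trans_eq (integral_const _))
      ((summable_pow_div_factorial M).const_smul _))
  have e1 : (fun k : ℕ => Complex.I ^ k / k ! * ((∫ a, g a ^ k * c a ∂μ : ℝ) : ℂ)) =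
      fun k : ℕ => ∫ a, Complex.I ^ k / k ! * ((g a ^ k * c a : ℝ) : ℂ) ∂μ := by
    funext k
    rw [integral_const_mul, integral_complex_ofReal]
  have e2 : ∫ a, Complex.exp (Complex.I * g a) * c a ∂μ =
      ∫ a, ∑' k : ℕ, Complex.I ^ k / k ! * ((g a ^ k * c a : ℝ) : ℂ) ∂μ := by
    refine integral_congr_ae (Filter.Eventually.of_forall fun a => ?_)
    have := (NormedSpace.expSeries_div_hasSum_exp (Complex.I * (g a : ℂ))).mul_right (c a : ℂ)
    rw [← Complex.exp_eq_exp_ℂ] at this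
    simp only
    rw [← this.tsum_eq]
    refine tsum_congr fun k => ?_
    push_cast
    rw [mul_pow]
    ring
  rw [e1, e2]
  exact key

/-- The Fourier transform of the surface measure of an odd-dimensional sphere. -/
theorem integral_sphere_cexp {m : ℕ} (hV : Module.finrank ℝ V = 2 * m + 2) (w : V) :
    (∫ y : Metric.sphere (0 : V) 1, Complex.exp (Complex.I * (inner ℝ (y : V) w : ℝ))
        ∂(volume : Measure V).toSphere) * (sinMoment m 0 : ℂ) =
      ((volume : Measure V).toSphere.real univ : ℂ) *
        ∫ θ in (-(π / 2))..(π / 2),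
          Complex.exp (Complex.I * (‖w‖ * sin θ : ℝ)) * ((cos θ ^ (2 * m) : ℝ) : ℂ) := by
  have h1 := hasSum_integral_cexp_mul (volume : Measure V).toSphere (M := ‖w‖)
    (g := fun y : Metric.sphere (0 : V) 1 => inner ℝ (y : V) w) (c := fun _ => 1)
    (Continuous.aestronglyMeasurable (by fun_prop)) aestronglyMeasurable_const
    (fun y => (abs_real_inner_le_norm _ _).trans (by simp)) (by simp)
  have h2 := hasSum_integral_cexp_mul (volume.restrict (Ioc (-(π / 2)) (π / 2))) (M := ‖w‖)
    (g := fun θ => ‖w‖ * sin θ) (c := fun θ => cos θ ^ (2 * m))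
    (Continuous.aestronglyMeasurable (by fun_prop)) (Continuous.aestronglyMeasurable (by fun_prop))
    (fun θ => by
      rw [abs_mul, abs_norm]
      exact mul_le_of_le_one_right (norm_nonneg _) (abs_sin_le_one θ))
    (fun θ => by
      rw [abs_pow]
      exact pow_le_one₀ (abs_nonneg _) (abs_cos_le_one θ))
  have h3 : sphereMoment w 0 = (volume : Measure V).toSphere.real univ := by simp [sphereMoment]
  rw [intervalIntegral.integral_of_le (by linarith [pi_pos])]
  simp only [Complex.ofReal_one, mul_one] at h1
  -- Both sides are sums of power series in the moments, so the coefficients may be compared one at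
  -- a time.
  refine (h1.mul_right (sinMoment m 0 : ℂ)).unique ?_
  convert h2.mul_left (((volume : Measure V).toSphere.real univ : ℝ) : ℂ) using 1
  funext k
  have h4 := sphereMoment_mul_sinMoment hV w k
  rw [h3] at h4
  have h5 : ∫ θ in Ioc (-(π / 2)) (π / 2), (‖w‖ * sin θ) ^ k * cos θ ^ (2 * m) =
      ‖w‖ ^ k * sinMoment m k := by
    rw [sinMoment, intervalIntegral.integral_of_le (by linarith [pi_pos]), ← integral_const_mul]
    congr 1
    funext θ
    ring
  rw [h5]
  have h6 : ((sphereMoment w k * sinMoment m 0 : ℝ) : ℂ) =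
      ((‖w‖ ^ k * sinMoment m k * (volume : Measure V).toSphere.real univ : ℝ) : ℂ) := by rw [h4]
  rw [sphereMoment] at h6
  push_cast at h6 ⊢
  linear_combination (Complex.I ^ k / k !) * h6

end Sphere

/-! ### Time and space second derivatives as entries of the space-time Hessian. -/

section SecondDerivatives

variable {V G : Type*} [NormedAddCommGroup V] [NormedSpace ℝ V]
  [NormedAddCommGroup G] [NormedSpace ℝ G]

theorem hasDerivAt_comp_prodMk {F : V × ℝ → G} {x : V} {t : ℝ}
    (hF : DifferentiableAt ℝ F (x, t)) :
    HasDerivAt (fun s => F (x, s)) (fderiv ℝ F (x, t) (0, 1)) t :=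
  hF.hasFDerivAt.comp_hasDerivAt t ((hasDerivAt_const t x).prodMk (hasDerivAt_id t))

theorem hasFDerivAt_comp_prodMk_left {F : V × ℝ → G} {x : V} {t : ℝ}
    (hF : DifferentiableAt ℝ F (x, t)) :
    HasFDerivAt (fun y => F (y, t)) ((fderiv ℝ F (x, t)).comp (.inl ℝ V ℝ)) x :=
  hF.hasFDerivAt.comp x (hasFDerivAt_prodMk_left x t)

theorem eventually_differentiableAt {F : V × ℝ → G} {p : V × ℝ} (hF : ContDiffAt ℝ 2 F p) :
    ∀ᶠ q in nhds p, DifferentiableAt ℝ F q := by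
  filter_upwards [hF.eventually (by simp)] with q hq
  exact hq.differentiableAt (by simp)

theorem differentiableAt_fderiv {F : V × ℝ → G} {p : V × ℝ} (hF : ContDiffAt ℝ 2 F p) :
    DifferentiableAt ℝ (fderiv ℝ F) p :=
  (hF.fderiv_right (m := 1) (by norm_num)).differentiableAt (by simp)

theorem iteratedDeriv_two_comp_prodMk {F : V × ℝ → G} {x : V} {t : ℝ}
    (hF : ContDiffAt ℝ 2 F (x, t)) :
    iteratedDeriv 2 (fun s => F (x, s)) t = iteratedFDeriv ℝ 2 F (x, t) ![(0, 1), (0, 1)] := by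
  have h1 : deriv (fun s => F (x, s)) =ᶠ[nhds t] fun s => fderiv ℝ F (x, s) (0, 1) := by
    have hc : Filter.Tendsto (fun s : ℝ => (x, s)) (nhds t) (nhds (x, t)) :=
      Continuous.tendsto (by fun_prop) t
    filter_upwards [hc.eventually (eventually_differentiableAt hF)] with s hs
    exact (hasDerivAt_comp_prodMk hs).deriv
  rw [iteratedDeriv_succ, iteratedDeriv_one, h1.deriv_eq, iteratedFDeriv_two_apply]
  have h2 := hasDerivAt_comp_prodMk (G := V × ℝ →L[ℝ] G) (differentiableAt_fderiv hF)
  exact (h2.clm_apply (hasDerivAt_const t ((0, 1) : V × ℝ))).deriv.trans (by simp)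

theorem iteratedFDeriv_two_comp_prodMk {F : V × ℝ → G} {x : V} {t : ℝ}
    (hF : ContDiffAt ℝ 2 F (x, t)) (e : V) :
    iteratedFDeriv ℝ 2 (fun y => F (y, t)) x ![e, e] =
      iteratedFDeriv ℝ 2 F (x, t) ![(e, 0), (e, 0)] := by
  have h1 : fderiv ℝ (fun y => F (y, t)) =ᶠ[nhds x]
      fun y => (fderiv ℝ F (y, t)).comp (.inl ℝ V ℝ) := by
    have hc : Filter.Tendsto (fun y : V => (y, t)) (nhds x) (nhds (x, t)) :=
      Continuous.tendsto (by fun_prop) x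
    filter_upwards [hc.eventually (eventually_differentiableAt hF)] with s hs
    exact (hasFDerivAt_comp_prodMk_left hs).fderiv
  rw [iteratedFDeriv_two_apply, iteratedFDeriv_two_apply, h1.fderiv_eq]
  have h2 := hasFDerivAt_comp_prodMk_left (G := V × ℝ →L[ℝ] G) (differentiableAt_fderiv hF)
  rw [(h2.clm_comp (hasFDerivAt_const (ContinuousLinearMap.inl ℝ V ℝ) x)).fderiv]
  simp

theorem laplacian_comp_prodMk {V G : Type*} [NormedAddCommGroup V] [InnerProductSpace ℝ V]
    [FiniteDimensional ℝ V] [NormedAddCommGroup G] [NormedSpace ℝ G] {F : V × ℝ → G} {x : V} {t : ℝ}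
    (hF : ContDiffAt ℝ 2 F (x, t)) {ι : Type*} [Fintype ι] (b : OrthonormalBasis ι ℝ V) :
    Δ (fun y => F (y, t)) x = ∑ i, iteratedFDeriv ℝ 2 F (x, t) ![(b i, 0), (b i, 0)] := by
  rw [InnerProductSpace.laplacian_eq_iteratedFDeriv_orthonormalBasis _ b]
  simp only [iteratedFDeriv_two_comp_prodMk hF]

end SecondDerivatives

/-! ### Waves as Fourier transforms of measures on the light cone. -/

section Solution

set_option linter.unusedSectionVars false

open scoped FourierTransform SchwartzMap

variable {V : Type*} [NormedAddCommGroup V] [InnerProductSpace ℝ V] [FiniteDimensional ℝ V]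
  [MeasurableSpace V] [BorelSpace V]

/-- The measure on the light cone `{(ξ, s) | s² = |ξ|²}` that projects to twice the volume. -/
noncomputable def coneMeasure (V : Type*) [NormedAddCommGroup V] [InnerProductSpace ℝ V]
    [FiniteDimensional ℝ V] [MeasurableSpace V] [BorelSpace V] : Measure (V × ℝ) :=
  (volume : Measure V).map (fun ξ => (ξ, ‖ξ‖)) + (volume : Measure V).map (fun ξ => (ξ, -‖ξ‖))

/-- The bilinear form `((ξ, s), (x, t)) ↦ -(⟨ξ, x⟩ + s t)`. -/
noncomputable def coneForm (V : Type*) [NormedAddCommGroup V] [InnerProductSpace ℝ V] :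
    (V × ℝ) →L[ℝ] (V × ℝ) →L[ℝ] ℝ :=
  let B : V →L[ℝ] V →L[ℝ] ℝ := innerSL ℝ;
  -(B.bilinearComp (.fst ℝ V ℝ) (.fst ℝ V ℝ) +
    (ContinuousLinearMap.mul ℝ ℝ).bilinearComp (.snd ℝ V ℝ) (.snd ℝ V ℝ))

theorem coneForm_apply (p q : V × ℝ) : coneForm V p q = -(inner ℝ p.1 q.1 + p.2 * q.2) := by
  simp [coneForm]
  rfl

theorem coneForm_toLinearMap_apply (p q : V × ℝ) :
    (coneForm V).toLinearMap₁₂ p q = -(inner ℝ p.1 q.1 + p.2 * q.2) :=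
  coneForm_apply p q

theorem measurable_prodMk_norm : Measurable (fun ξ : V => (ξ, ‖ξ‖)) := by fun_prop

theorem measurable_prodMk_neg_norm : Measurable (fun ξ : V => (ξ, -‖ξ‖)) := by fun_prop

theorem integrable_coneMeasure_iff {G : Type*} [NormedAddCommGroup G] {F : V × ℝ → G}
    (hF : Continuous F) : Integrable F (coneMeasure V) ↔
      Integrable (fun ξ : V => F (ξ, ‖ξ‖)) ∧ Integrable (fun ξ : V => F (ξ, -‖ξ‖)) := by
  rw [coneMeasure, integrable_add_measure,
    integrable_map_measure (hF.stronglyMeasurable.aestronglyMeasurable)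
      measurable_prodMk_norm.aemeasurable,
    integrable_map_measure (hF.stronglyMeasurable.aestronglyMeasurable)
      measurable_prodMk_neg_norm.aemeasurable]
  rfl

/-- The complex wave with amplitude `a`:
`(x, t) ↦ ∫ e^{2πi⟨ξ,x⟩} cos(2πt|ξ|) a(ξ) dξ`, see `complexWave_eq`. -/
noncomputable def complexWave (a : 𝓢(V, ℂ)) : V × ℝ → ℂ :=
  VectorFourier.fourierIntegral 𝐞 (coneMeasure V) (coneForm V).toLinearMap₁₂
    (fun p => (1 / 2 : ℂ) * a p.1)

theorem integrable_pow_mul_amplitude (a : 𝓢(V, ℂ)) (k : ℕ) :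
    Integrable (fun p : V × ℝ => ‖p‖ ^ k * ‖(1 / 2 : ℂ) * a p.1‖) (coneMeasure V) := by
  rw [integrable_coneMeasure_iff (by have := a.continuous; fun_prop)]
  have h := (a.integrable_pow_mul volume k).const_mul (1 / 2)
  constructor <;>
  · refine h.congr (Filter.Eventually.of_forall fun ξ => ?_)
    simp
    ring

theorem continuous_amplitude (a : 𝓢(V, ℂ)) :
    Continuous (fun p : V × ℝ => (1 / 2 : ℂ) * a p.1) := by
  have := a.continuous
  fun_prop

theorem integrable_amplitude (a : 𝓢(V, ℂ)) :
    Integrable (fun p : V × ℝ => (1 / 2 : ℂ) * a p.1) (coneMeasure V) := by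
  refine (integrable_norm_iff (continuous_amplitude a).aestronglyMeasurable).1 ?_
  simpa using integrable_pow_mul_amplitude a 0

/-- Schwartz decay makes every moment of the amplitude on the cone finite, so smoothness in space
and time comes at once from the Fourier transform. -/
theorem contDiff_complexWave (a : 𝓢(V, ℂ)) : ContDiff ℝ ∞ (complexWave a) :=
  VectorFourier.contDiff_fourierIntegral (N := ⊤) _ fun k _ => integrable_pow_mul_amplitude a k

theorem integral_coneMeasure {F : V × ℝ → ℂ} (hF : Continuous F)
    (hi : Integrable F (coneMeasure V)) :
    ∫ p, F p ∂(coneMeasure V) = ∫ ξ : V, (F (ξ, ‖ξ‖) + F (ξ, -‖ξ‖)) := by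
  obtain ⟨h1, h2⟩ := (integrable_coneMeasure_iff hF).1 hi
  rw [integral_add h1 h2]
  rw [coneMeasure, integrable_add_measure] at hi
  rw [coneMeasure, integral_add_measure hi.1 hi.2,
    integral_map measurable_prodMk_norm.aemeasurable hF.aestronglyMeasurable,
    integral_map measurable_prodMk_neg_norm.aemeasurable hF.aestronglyMeasurable]

/-- The two sheets `s = ±|ξ|` contribute conjugate exponentials in `t`; their sum is twice a cosine,
which cancels the factor `1/2` in the amplitude. -/
theorem complexWave_eq (a : 𝓢(V, ℂ)) (x : V) (t : ℝ) :
    complexWave a (x, t) =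
      ∫ ξ : V, (𝐞 (inner ℝ ξ x) : ℂ) * ((cos (2 * π * t * ‖ξ‖) : ℝ) * a ξ) := by
  have hc : Continuous (fun p : V × ℝ =>
      𝐞 (-(coneForm V).toLinearMap₁₂ p (x, t)) • ((1 / 2 : ℂ) * a p.1)) := by
    have h1 := a.continuous
    have h2 := Real.continuous_fourierChar
    have h3 : Continuous (fun p : V × ℝ => -(coneForm V).toLinearMap₁₂ p (x, t)) := by
      simp only [coneForm_toLinearMap_apply]
      fun_prop
    exact (h2.comp h3).smul (by fun_prop)
  rw [complexWave, VectorFourier.fourierIntegral, integral_coneMeasure hc]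
  · congr 1
    funext ξ
    simp only [coneForm_toLinearMap_apply, neg_neg,
      AddChar.map_add_eq_mul, Circle.smul_def, Circle.coe_mul, smul_eq_mul]
    have h : (𝐞 (‖ξ‖ * t) : ℂ) + (𝐞 (-‖ξ‖ * t) : ℂ) = 2 * (cos (2 * π * t * ‖ξ‖) : ℝ) := by
      rw [Real.fourierChar_apply, Real.fourierChar_apply, Complex.ofReal_cos, Complex.two_cos]
      congr 2
      · push_cast; ring
      · push_cast; ring
    linear_combination ((𝐞 (inner ℝ ξ x) : ℂ) * (1 / 2 * a ξ)) * h
  · refine (integrable_norm_iff hc.aestronglyMeasurable).1 ?_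
    simpa [Circle.norm_smul] using (integrable_amplitude a).norm

theorem ae_coneMeasure : ∀ᵐ p : V × ℝ ∂(coneMeasure V), p.2 ^ 2 = ‖p.1‖ ^ 2 := by
  have hm : MeasurableSet {p : V × ℝ | p.2 ^ 2 = ‖p.1‖ ^ 2} :=
    (isClosed_eq (by fun_prop) (by fun_prop)).measurableSet
  rw [coneMeasure, ae_add_measure_iff, ae_map_iff measurable_prodMk_norm.aemeasurable hm,
    ae_map_iff measurable_prodMk_neg_norm.aemeasurable hm]
  simp

/-- Second derivatives multiply the amplitude by the same constant times `s²` in time and `|ξ|²` in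
space, and these agree on the cone that carries the measure. -/
theorem complexWave_wave_eq (a : 𝓢(V, ℂ)) {ι : Type*} [Fintype ι] (b : OrthonormalBasis ι ℝ V)
    (p : V × ℝ) :
    iteratedFDeriv ℝ 2 (complexWave a) p ![(0, 1), (0, 1)] =
      ∑ i, iteratedFDeriv ℝ 2 (complexWave a) p ![(b i, 0), (b i, 0)] := by
  have hi := VectorFourier.integrable_fourierPowSMulRight (coneForm V)
    (integrable_pow_mul_amplitude a 2) (continuous_amplitude a).aestronglyMeasurable
  rw [complexWave, VectorFourier.iteratedFDeriv_fourierIntegral (N := ⊤) (coneForm V)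
    (fun k _ => integrable_pow_mul_amplitude a k) (continuous_amplitude a).aestronglyMeasurable
    le_top]
  simp only [fourierIntegral_continuousMultilinearMap_apply' hi]
  have hi2 : ∀ m : Fin 2 → V × ℝ, Integrable (fun v => 𝐞 (-(coneForm V).toLinearMap₁₂ v p) •
      VectorFourier.fourierPowSMulRight (coneForm V) (fun p => (1 / 2 : ℂ) * a p.1) v 2 m)
      (coneMeasure V) := fun m =>
    (VectorFourier.fourierIntegral_convergent_iff Real.continuous_fourierChar
      (by exact (coneForm V).continuous₂) p).2
      ((ContinuousMultilinearMap.apply ℝ (fun _ : Fin 2 => V × ℝ) ℂ m).integrable_comp hi)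
  simp only [VectorFourier.fourierIntegral]
  rw [← integral_finsetSum _ fun i _ => hi2 _]
  refine integral_congr_ae ?_
  filter_upwards [ae_coneMeasure] with q hq
  simp only [← Finset.smul_sum, VectorFourier.fourierPowSMulRight_apply, Fin.prod_univ_two,
    coneForm_apply, ← Finset.sum_smul]
  congr 3
  simp [hq, ← b.sum_sq_inner_left q.1, ← sq]

end Solution

/-! ### Spherical means as time averages of the wave. -/

section SphericalMean

open scoped FourierTransform SchwartzMap

theorem integral_symm_eq_integral_add {g : ℝ → ℂ} (hg : Continuous g) (a : ℝ) :
    ∫ θ in (-a)..a, g θ = ∫ θ in (0 : ℝ)..a, (g θ + g (-θ)) := by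
  have h1 : ∫ θ in (0 : ℝ)..a, g (-θ) = ∫ θ in (-a)..0, g θ := by
    simp
  rw [intervalIntegral.integral_add (hg.intervalIntegrable _ _)
    (Continuous.intervalIntegrable (by fun_prop) _ _), h1, add_comm,
    intervalIntegral.integral_add_adjacent_intervals (hg.intervalIntegrable _ _)
    (hg.intervalIntegrable _ _)]

theorem sinMoment_zero_eq (m : ℕ) :
    sinMoment m 0 = 2 * ∫ θ in (0 : ℝ)..(π / 2), cos θ ^ (2 * m) := by
  have h := integral_symm_eq_integral_add (g := fun θ => ((cos θ ^ (2 * m) : ℝ) : ℂ))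
    (by fun_prop) (π / 2)
  simp only [cos_neg, ← two_mul] at h
  rw [intervalIntegral.integral_const_mul, intervalIntegral.integral_ofReal,
    intervalIntegral.integral_ofReal] at h
  simp only [sinMoment, pow_zero, one_mul]
  exact_mod_cast h

theorem integral_cos_pow_even_pos (m : ℕ) : 0 < ∫ θ in (0 : ℝ)..(π / 2), cos θ ^ (2 * m) := by
  refine intervalIntegral.intervalIntegral_pos_of_pos_on
    (Continuous.intervalIntegrable (by fun_prop) _ _) (fun θ hθ => ?_) (by positivity)
  have : 0 < cos θ := cos_pos_of_mem_Ioo ⟨by linarith [hθ.1, pi_pos], hθ.2⟩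
  positivity

variable {V : Type*} [NormedAddCommGroup V] [InnerProductSpace ℝ V] [FiniteDimensional ℝ V]
  [MeasurableSpace V] [BorelSpace V]

/-- Folding `[-π/2, π/2]` onto `[0, π/2]` pairs conjugate exponentials, which leaves only cosines.
-/
theorem integral_sphere_cexp_eq_cos {m : ℕ} (hV : Module.finrank ℝ V = 2 * m + 2) (w : V) :
    (∫ y : Metric.sphere (0 : V) 1, Complex.exp (Complex.I * (inner ℝ (y : V) w : ℝ))
        ∂(volume : Measure V).toSphere) * ((∫ θ in (0 : ℝ)..(π / 2), cos θ ^ (2 * m) : ℝ) : ℂ) =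
      ((volume : Measure V).toSphere.real univ : ℂ) *
        ∫ θ in (0 : ℝ)..(π / 2), ((cos (‖w‖ * sin θ) * cos θ ^ (2 * m) : ℝ) : ℂ) := by
  have h := integral_sphere_cexp hV w
  rw [integral_symm_eq_integral_add (by fun_prop), sinMoment_zero_eq] at h
  have e : ∀ θ : ℝ, Complex.exp (Complex.I * (‖w‖ * sin θ : ℝ)) * ((cos θ ^ (2 * m) : ℝ) : ℂ) +
      Complex.exp (Complex.I * (‖w‖ * sin (-θ) : ℝ)) * ((cos (-θ) ^ (2 * m) : ℝ) : ℂ) =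
      2 * ((cos (‖w‖ * sin θ) * cos θ ^ (2 * m) : ℝ) : ℂ) := fun θ => by
    rw [cos_neg, sin_neg, ← add_mul, Complex.ofReal_mul (cos (‖w‖ * sin θ)), Complex.ofReal_cos,
      ← mul_assoc, Complex.two_cos]
    congr 3 <;> (push_cast; ring)
  simp only [e] at h
  rw [intervalIntegral.integral_const_mul] at h
  push_cast at h ⊢
  linear_combination (1 / 2 : ℂ) * h

theorem integrable_amplitude_smul {α : Type*} [TopologicalSpace α] [MeasurableSpace α]
    [OpensMeasurableSpace α] [SecondCountableTopology α]
    (μ : Measure α) [IsFiniteMeasure μ] (a : 𝓢(V, ℂ))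
    {c : α × V → ℂ} (hc : Continuous c) (hc1 : ∀ p, ‖c p‖ ≤ 1) :
    Integrable (fun p : α × V => c p * a p.2) (μ.prod volume) := by
  have h := (a.integrable (μ := volume)).comp_snd μ
  refine h.bdd_mul (c := 1) hc.aestronglyMeasurable (Filter.Eventually.of_forall hc1)

/-- The spherical means of the trace at time `0` of a complex wave, in terms of the wave. -/
theorem integral_sphere_eq_integral_complexWave {m : ℕ} (hV : Module.finrank ℝ V = 2 * m + 2)
    (a : 𝓢(V, ℂ)) {f : V → ℂ} (hf : ∀ x, f x = ∫ ξ, (𝐞 (inner ℝ ξ x) : ℂ) * a ξ) (x : V) {r : ℝ}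
    (hr : 0 ≤ r) :
    (∫ y : Metric.sphere (0 : V) 1, f (x + r • (y : V)) ∂(volume : Measure V).toSphere) *
        ((∫ θ in (0 : ℝ)..(π / 2), cos θ ^ (2 * m) : ℝ) : ℂ) =
      ((volume : Measure V).toSphere.real univ : ℂ) *
        ∫ θ in (0 : ℝ)..(π / 2), complexWave a (x, r * sin θ) * ((cos θ ^ (2 * m) : ℝ) : ℂ) := by
  have hch := Real.continuous_fourierChar
  have hch' : Continuous (fun s : ℝ => (𝐞 s : ℂ)) := by fun_prop
  -- Fubini puts the sphere integral innermost, as a Fourier transform at frequency `2πrξ`. The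
  -- counterpart `hR` treats the time average likewise, so that it remains to compare integrands in
  -- `ξ`.
  have hL : ∫ y : Metric.sphere (0 : V) 1, f (x + r • (y : V)) ∂(volume : Measure V).toSphere =
      ∫ ξ : V, (𝐞 (inner ℝ ξ x) : ℂ) * a ξ * ∫ y : Metric.sphere (0 : V) 1,
        Complex.exp (Complex.I * (inner ℝ (y : V) ((2 * π * r) • ξ) : ℝ))
          ∂(volume : Measure V).toSphere := by
    simp only [hf]
    rw [integral_integral_swap]
    · congr 1
      funext ξ
      rw [← integral_const_mul]
      congr 1
      funext y
      rw [inner_add_right, AddChar.map_add_eq_mul, Circle.coe_mul, Real.fourierChar_apply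
        (inner ℝ ξ (r • (y : V)))]
      have : (2 * π * inner ℝ ξ (r • (y : V)) : ℝ) * Complex.I =
          Complex.I * (inner ℝ (y : V) ((2 * π * r) • ξ) : ℝ) := by
        rw [inner_smul_right, inner_smul_right, real_inner_comm]
        push_cast
        ring
      rw [← this]
      push_cast
      ring
    · exact integrable_amplitude_smul (volume : Measure V).toSphere a
        (c := fun p => (𝐞 (inner ℝ p.2 (x + r • (p.1 : V))) : ℂ)) (by fun_prop)
        (fun p => (Circle.norm_coe _).le)
  have hR : ∫ θ in (0 : ℝ)..(π / 2), complexWave a (x, r * sin θ) * ((cos θ ^ (2 * m) : ℝ) : ℂ) =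
      ∫ ξ : V, (𝐞 (inner ℝ ξ x) : ℂ) * a ξ * ∫ θ in (0 : ℝ)..(π / 2),
        ((cos (‖(2 * π * r) • ξ‖ * sin θ) * cos θ ^ (2 * m) : ℝ) : ℂ) := by
    have hp : (0 : ℝ) ≤ π / 2 := by positivity
    simp only [complexWave_eq, intervalIntegral.integral_of_le hp, ← integral_mul_const,
      ← integral_const_mul]
    rw [integral_integral_swap]
    · congr 1
      funext ξ
      congr 1
      funext θ
      rw [norm_smul, norm_of_nonneg (by positivity : 0 ≤ 2 * π * r),
        show 2 * π * (r * sin θ) * ‖ξ‖ = 2 * π * r * ‖ξ‖ * sin θ by ring]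
      push_cast
      ring
    · refine (integrable_amplitude_smul (volume.restrict (Ioc 0 (π / 2))) a
        (c := fun p => (𝐞 (inner ℝ p.2 x) : ℂ) * ((cos (2 * π * (r * sin p.1) * ‖p.2‖) : ℝ) *
          ((cos p.1 ^ (2 * m) : ℝ) : ℂ))) (by fun_prop) (fun p => ?_)).congr
        (Filter.Eventually.of_forall fun p => ?_)
      · rw [norm_mul, norm_mul, Circle.norm_coe, one_mul, Complex.norm_real, Complex.norm_real,
          norm_pow]
        exact mul_le_one₀ (abs_cos_le_one _) (by positivity)
          (pow_le_one₀ (norm_nonneg _) (abs_cos_le_one _))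
      · simp only [Function.uncurry]
        ring
  rw [hL, hR, ← integral_mul_const, ← integral_const_mul]
  congr 1
  funext ξ
  linear_combination ((𝐞 (inner ℝ ξ x) : ℂ) * a ξ) *
    integral_sphere_cexp_eq_cos hV ((2 * π * r) • ξ)

end SphericalMean

/-! ### The smooth real solution with datum `f`. -/

section RealWave

open scoped FourierTransform SchwartzMap

/-- A smooth compactly supported function launches a smooth wave, even in time, and its spherical
means are averages of that wave. -/
theorem exists_smooth_wave {n m : ℕ} (hn : n = 2 * m + 2) {f : EuclideanSpace ℝ (Fin n) → ℝ}
    (hf : ContDiff ℝ ∞ f) (hfc : HasCompactSupport f) :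
    ∃ w : EuclideanSpace ℝ (Fin n) × ℝ → ℝ, ContDiff ℝ ∞ w ∧
      IsWaveSolution f (fun _ => 0) (fun x t => w (x, t)) ∧ (∀ x t, w (x, -t) = w (x, t)) ∧
      ∀ x r, 0 ≤ r → sphericalMean f x r = (∫ θ in (0 : ℝ)..(π / 2), cos θ ^ (2 * m))⁻¹ *
        ∫ θ in (0 : ℝ)..(π / 2), w (x, r * sin θ) * cos θ ^ (2 * m) := by
  have hV : Module.finrank ℝ (EuclideanSpace ℝ (Fin n)) = 2 * m + 2 := by simp [hn]
  have hfC : ContDiff ℝ ∞ (fun x => (f x : ℂ)) := Complex.ofRealCLM.contDiff.comp hf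
  have hfcC : HasCompactSupport (fun x => (f x : ℂ)) :=
    hfc.comp_left (g := fun s : ℝ => (s : ℂ)) Complex.ofReal_zero
  set F : 𝓢(EuclideanSpace ℝ (Fin n), ℂ) := hfcC.toSchwartzMap hfC with hF
  have hinv : ∀ x, (f x : ℂ) = ∫ ξ, (𝐞 (inner ℝ ξ x) : ℂ) * (𝓕 F) ξ := fun x => by
    have h1 : 𝓕⁻ (𝓕 F) = F := FourierTransform.fourierInv_fourier_eq F
    have h2 : (f x : ℂ) = (𝓕⁻ (𝓕 F)) x := by rw [h1]; rfl
    rw [h2, SchwartzMap.fourierInv_coe, Real.fourierInv_eq]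
    rfl
  set W := complexWave (𝓕 F) with hW
  have hWs : ContDiff ℝ ∞ W := contDiff_complexWave _
  have hws : ContDiff ℝ ∞ (fun p => (W p).re) := Complex.reCLM.contDiff.comp hWs
  have hWs2 : ContDiff ℝ 2 W := mod_cast contDiff_infty.1 hWs 2
  have hws2 : ContDiff ℝ 2 (fun p => (W p).re) := mod_cast contDiff_infty.1 hws 2
  have heven : ∀ x t, (W (x, -t)).re = (W (x, t)).re := fun x t => by
    rw [hW, complexWave_eq, complexWave_eq]
    simp [cos_neg]
  -- Taking real parts commutes with the wave operator and keeps the datum, since `f` is real.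
  refine ⟨fun p => (W p).re, hws, ?_, heven, ?_⟩
  · constructor
    · exact hws2.contDiffOn
    · exact (hws2.of_le one_le_two).contDiffOn
    · intro x t _
      have h2 : ContDiffAt ℝ 2 (fun p => (W p).re) (x, t) := hws2.contDiffAt
      rw [iteratedDeriv_two_comp_prodMk h2,
        laplacian_comp_prodMk h2 (EuclideanSpace.basisFun (Fin n) ℝ), sub_eq_zero]
      have h3 := Complex.reCLM.iteratedFDeriv_comp_left (f := W) (x := (x, t)) (n := 2) (i := 2)
        hWs2.contDiffAt le_rfl
      have h4 : iteratedFDeriv ℝ 2 (fun p => (W p).re) (x, t) =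
        Complex.reCLM.compContinuousMultilinearMap (iteratedFDeriv ℝ 2 W (x, t)) := h3
      rw [h4]
      simp only [ContinuousLinearMap.compContinuousMultilinearMap_coe, Function.comp]
      rw [hW, complexWave_wave_eq _ (EuclideanSpace.basisFun (Fin n) ℝ), map_sum]
    · intro x
      have : W (x, 0) = f x := by
        rw [hW, complexWave_eq, hinv]
        simp
      simp [this]
    · intro x
      have hd : DifferentiableAt ℝ (fun t => (W (x, t)).re) 0 :=
        (hws.comp (contDiff_prodMk_right x)).differentiable (by simp) 0
      rw [hd.derivWithin (uniqueDiffWithinAt_Ici 0)]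
      -- A function even in `t` has a derivative at `0` equal to its own negative.
      have h1 := deriv_comp_neg (fun t => (W (x, t)).re) 0
      simp only [heven, neg_zero] at h1
      linarith
  · intro x r hr
    have h := integral_sphere_eq_integral_complexWave hV (𝓕 F) hinv x hr
    have hc : Continuous (fun θ : ℝ => W (x, r * sin θ) * ((cos θ ^ (2 * m) : ℝ) : ℂ)) := by
      have := hWs.continuous
      fun_prop
    have h2 := congrArg Complex.re h
    rw [integral_complex_ofReal, ← Complex.ofReal_mul, Complex.ofReal_re, Complex.re_ofReal_mul] at h2
    have h3 : (∫ θ in (0 : ℝ)..(π / 2), W (x, r * sin θ) * ((cos θ ^ (2 * m) : ℝ) : ℂ)).re =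
        ∫ θ in (0 : ℝ)..(π / 2), (W (x, r * sin θ)).re * cos θ ^ (2 * m) := by
      have := Complex.reCLM.intervalIntegral_comp_comm (hc.intervalIntegrable 0 (π / 2) (μ := volume))
      simp only [Complex.reCLM_apply, Complex.re_mul_ofReal] at this
      exact this.symm
    rw [← hW, h3, Measure.toSphere_real_apply_univ] at h2
    simp only [finrank_euclideanSpace, Fintype.card_fin] at h2
    have hJ := (integral_cos_pow_even_pos m).ne'
    have hS : (n : ℝ) * volume.real (Metric.ball (0 : EuclideanSpace ℝ (Fin n)) 1) ≠ 0 := by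
      have : 0 < volume.real (Metric.ball (0 : EuclideanSpace ℝ (Fin n)) 1) :=
        ENNReal.toReal_pos (Metric.measure_ball_pos volume 0 one_pos).ne' measure_ball_lt_top.ne
      have : (0 : ℝ) < n := by rw [hn]; positivity
      positivity
    rw [sphericalMean, inv_mul_eq_iff_eq_mul₀ hS]
    refine mul_right_cancel₀ hJ ?_
    rw [h2]
    field_simp

end RealWave

/-! ### Weighted energy in a backward light cone. -/

section Energy

set_option linter.unusedSectionVars false

/-- The square of the positive part is still `C¹` at the kink. Hence the squared cone weight can be
differentiated on the whole space, and no integrals over the lateral boundary are needed. -/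
theorem hasDerivAt_max_zero_sq (s : ℝ) :
    HasDerivAt (fun s : ℝ => max s 0 ^ 2) (2 * max s 0) s := by
  refine hasDerivAt_of_hasDerivAt_of_ne' (x := 0) (g := fun s => 2 * max s 0) (fun y hy => ?_)
    (Continuous.continuousAt (by fun_prop)) (Continuous.continuousAt (by fun_prop)) s
  rcases hy.lt_or_gt with hy | hy
  · have h : (fun s : ℝ => max s 0 ^ 2) =ᶠ[nhds y] fun _ => 0 := by
      filter_upwards [Iio_mem_nhds hy] with s hs
      simp [max_eq_right (mem_Iio.1 hs).le]
    simpa [max_eq_right hy.le] using (hasDerivAt_const y (0 : ℝ)).congr_of_eventuallyEq h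
  · have h : (fun s : ℝ => max s 0 ^ 2) =ᶠ[nhds y] fun s => s ^ 2 := by
      filter_upwards [Ioi_mem_nhds hy] with s hs
      simp [max_eq_left (mem_Ioi.1 hs).le]
    simpa [max_eq_left hy.le] using (hasDerivAt_pow 2 y).congr_of_eventuallyEq h

theorem integrable_of_eq_zero_off_compact {V : Type*} [NormedAddCommGroup V] [MeasurableSpace V]
    [BorelSpace V] {μ : Measure V} [IsFiniteMeasureOnCompacts μ] {K : Set V} (hK : IsCompact K)
    {h : V → ℝ} (hc : Continuous h) (h0 : ∀ y ∉ K, h y = 0) : Integrable h μ :=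
  hc.integrable_of_hasCompactSupport (HasCompactSupport.intro hK h0)

/-- Differentiation under the integral sign for compactly supported integrands. -/
theorem hasDerivAt_integral_of_compact_support {V : Type*} [NormedAddCommGroup V]
    [SecondCountableTopology V] [MeasurableSpace V] [BorelSpace V] {μ : Measure V}
    [IsFiniteMeasureOnCompacts μ] {U : Set ℝ} (hU : IsOpen U) {K : Set V} (hK : IsCompact K)
    {g g' : ℝ → V → ℝ} (hg : ∀ s ∈ U, Continuous (g s))
    (hg' : ContinuousOn (Function.uncurry g') (U ×ˢ univ))
    (hd : ∀ s ∈ U, ∀ y, HasDerivAt (fun s => g s y) (g' s y) s)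
    (h0 : ∀ s ∈ U, ∀ y ∉ K, g s y = 0) {t : ℝ} (ht : t ∈ U) :
    HasDerivAt (fun s => ∫ y, g s y ∂μ) (∫ y, g' t y ∂μ) t := by
  -- Since `U` is open, off `K` the function vanishes for all nearby times, hence so does its time
  -- derivative.
  have h0' : ∀ s ∈ U, ∀ y ∉ K, g' s y = 0 := fun s hs y hy => by
    have h : (fun s => g s y) =ᶠ[nhds s] fun _ => 0 := by
      filter_upwards [hU.mem_nhds hs] with r hr using h0 r hr y hy
    exact (hd s hs y).unique ((hasDerivAt_const s (0 : ℝ)).congr_of_eventuallyEq h)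
  obtain ⟨ε, hε, hεU⟩ := Metric.nhds_basis_closedBall.mem_iff.1 (hU.mem_nhds ht)
  obtain ⟨C, hC⟩ := ((isCompact_closedBall t ε).prod hK).exists_bound_of_continuousOn
    (hg'.mono (prod_mono hεU (subset_univ K)))
  have hcg' : Continuous (g' t) := by
    rw [← continuousOn_univ]
    exact hg'.comp (f := fun y => (t, y)) (by fun_prop) fun y _ => ⟨ht, mem_univ y⟩
  refine (hasDerivAt_integral_of_dominated_loc_of_deriv_le (F' := g')
    (bound := K.indicator fun _ => C)
    (Metric.closedBall_mem_nhds t hε) ?_ ?_ hcg'.aestronglyMeasurable ?_ ?_ ?_).2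
  · filter_upwards [hU.mem_nhds ht] with s hs using (hg s hs).aestronglyMeasurable
  · exact integrable_of_eq_zero_off_compact hK (hg t ht) (h0 t ht)
  · refine Filter.Eventually.of_forall fun y s hs => ?_
    by_cases hy : y ∈ K
    · simpa [hy] using hC (s, y) ⟨hs, hy⟩
    · simp [hy, h0' s (hεU hs) y hy]
  · exact (integrable_indicator_iff hK.measurableSet).2 (integrableOn_const hK.measure_ne_top)
  · exact Filter.Eventually.of_forall fun y s hs => hd s (hεU hs) y

variable {V : Type*} [NormedAddCommGroup V] [InnerProductSpace ℝ V] {ι : Type*} [Fintype ι]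

/-- The function `max ((R - t)² - |y - x₀|²) 0`, positive exactly inside the light cone. -/
noncomputable def conePart (x₀ : V) (R : ℝ) (p : V × ℝ) : ℝ :=
  max ((R - p.2) ^ 2 - ‖p.1 - x₀‖ ^ 2) 0

theorem continuous_conePart (x₀ : V) (R : ℝ) : Continuous (conePart x₀ R) := by
  unfold conePart
  fun_prop

theorem conePart_nonneg (x₀ : V) (R : ℝ) (p : V × ℝ) : 0 ≤ conePart x₀ R p := le_max_right _ _

theorem conePart_eq_zero {x₀ : V} {R t : ℝ} (ht0 : 0 ≤ t) (htR : t ≤ R) {y : V}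
    (hy : y ∉ Metric.ball x₀ R) : conePart x₀ R (y, t) = 0 := by
  have h1 : R ≤ ‖y - x₀‖ := by simpa [dist_eq_norm] using hy
  refine max_eq_right ?_
  simp only
  nlinarith [norm_nonneg (y - x₀)]

theorem conePart_pos {x₀ : V} {R t : ℝ} {y : V} (hy : ‖y - x₀‖ < R - t) :
    0 < conePart x₀ R (y, t) := by
  refine lt_max_of_lt_left ?_
  simp only
  nlinarith [norm_nonneg (y - x₀)]

theorem hasDerivAt_conePart_sq_time (x₀ : V) (R : ℝ) (y : V) (t : ℝ) :
    HasDerivAt (fun s => conePart x₀ R (y, s) ^ 2) (-4 * conePart x₀ R (y, t) * (R - t)) t := by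
  have h1 : HasDerivAt (fun s : ℝ => (R - s) ^ 2 - ‖y - x₀‖ ^ 2) (2 * (R - t) * (-1)) t := by
    simpa using (((hasDerivAt_id t).const_sub R).pow 2).sub_const (‖y - x₀‖ ^ 2)
  refine ((hasDerivAt_max_zero_sq _).comp t h1).congr_deriv ?_
  simp only [conePart]
  ring

theorem hasLineDerivAt_conePart_sq (x₀ : V) (R : ℝ) (y e : V) (t : ℝ) :
    HasLineDerivAt ℝ (fun y => conePart x₀ R (y, t) ^ 2)
      (-4 * conePart x₀ R (y, t) * inner ℝ (y - x₀) e) y e := by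
  have h0 : HasDerivAt (fun s : ℝ => y + s • e - x₀) e 0 := by
    simpa using (((hasDerivAt_id (0 : ℝ)).smul_const e).const_add y).sub_const x₀
  have h1 : HasDerivAt (fun s : ℝ => (R - t) ^ 2 - ‖y + s • e - x₀‖ ^ 2)
      (-(2 * inner ℝ (y - x₀) e)) 0 := by
    simpa using h0.norm_sq.const_sub ((R - t) ^ 2)
  refine ((hasDerivAt_max_zero_sq _).comp 0 h1).congr_deriv ?_
  simp only [conePart, zero_smul, add_zero]
  ring

/-- The energy density of a linear form on space-time. -/
noncomputable def energyDensity (b : OrthonormalBasis ι ℝ V) (A : V × ℝ →L[ℝ] ℝ) : ℝ :=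
  (A (0, 1) ^ 2 + ∑ i, A (b i, 0) ^ 2) / 2

theorem continuous_energyDensity (b : OrthonormalBasis ι ℝ V) : Continuous (energyDensity b) := by
  unfold energyDensity
  fun_prop

theorem energyDensity_nonneg (b : OrthonormalBasis ι ℝ V) (A : V × ℝ →L[ℝ] ℝ) :
    0 ≤ energyDensity b A := by
  unfold energyDensity
  positivity

/-- The energy flux through the lateral boundary of the cone points outwards. -/
theorem flux_le_energyDensity (b : OrthonormalBasis ι ℝ V) (A : V × ℝ →L[ℝ] ℝ) {z : V} {c : ℝ}
    (hc : 0 < c) (hz : ‖z‖ ≤ c) :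
    A (0, 1) * ∑ i, inner ℝ z (b i) * A (b i, 0) ≤ c * energyDensity b A := by
  have h1 := Finset.sum_mul_sq_le_sq_mul_sq Finset.univ (fun i => inner ℝ z (b i))
    (fun i => A (b i, 0))
  rw [b.sum_sq_inner_left] at h1
  unfold energyDensity
  set S := ∑ i, inner ℝ z (b i) * A (b i, 0)
  set G := ∑ i, A (b i, 0) ^ 2 with hG
  have hG0 : 0 ≤ G := by positivity
  have h2 : ‖z‖ ^ 2 ≤ c ^ 2 := by gcongr
  have h3 : S ^ 2 ≤ c ^ 2 * G := h1.trans (by gcongr)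
  refine le_of_mul_le_mul_left ?_ hc
  -- Young's inequality `2 c A S ≤ c² A² + S²` together with the Cauchy–Schwarz bound `S² ≤ c² G`.
  nlinarith [sq_nonneg (c * A (0, 1) - S)]

variable {F : V × ℝ → ℝ}

theorem contDiffAt_of_pos (hF : ContDiffOn ℝ 2 F (univ ×ˢ Ioi (0 : ℝ))) (y : V) {t : ℝ}
    (ht : 0 < t) : ContDiffAt ℝ 2 F (y, t) :=
  hF.contDiffAt ((isOpen_univ.prod isOpen_Ioi).mem_nhds ⟨mem_univ y, ht⟩)

theorem continuousOn_fderiv_half (hF : ContDiffOn ℝ 2 F (univ ×ˢ Ioi (0 : ℝ))) :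
    ContinuousOn (fderiv ℝ F) (univ ×ˢ Ioi (0 : ℝ)) :=
  hF.continuousOn_fderiv_of_isOpen (isOpen_univ.prod isOpen_Ioi) (by norm_num)

theorem continuousOn_fderiv_fderiv_half (hF : ContDiffOn ℝ 2 F (univ ×ˢ Ioi (0 : ℝ))) :
    ContinuousOn (fderiv ℝ (fderiv ℝ F)) (univ ×ˢ Ioi (0 : ℝ)) :=
  (hF.fderiv_of_isOpen (m := 1) (isOpen_univ.prod isOpen_Ioi)
    (by norm_num)).continuousOn_fderiv_of_isOpen (isOpen_univ.prod isOpen_Ioi) le_rfl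

theorem continuous_slice {G : Type*} [TopologicalSpace G] {H : V × ℝ → G}
    (hH : ContinuousOn H (univ ×ˢ Ioi (0 : ℝ))) {t : ℝ} (ht : 0 < t) :
    Continuous (fun y => H (y, t)) := by
  rw [← continuousOn_univ]
  exact hH.comp (f := fun y => (y, t)) (by fun_prop) fun y _ => ⟨mem_univ y, ht⟩

theorem hasLineDerivAt_fderiv_apply {y : V} {t : ℝ} (hF : ContDiffAt ℝ 2 F (y, t)) (e : V)
    (m : V × ℝ) :
    HasLineDerivAt ℝ (fun y => fderiv ℝ F (y, t) m) (fderiv ℝ (fderiv ℝ F) (y, t) (e, 0) m) y e := by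
  have h := hasFDerivAt_comp_prodMk_left (G := V × ℝ →L[ℝ] ℝ) (differentiableAt_fderiv hF)
  have h2 := (h.clm_apply (hasFDerivAt_const m y)).hasLineDerivAt e
  simpa using h2

theorem hasDerivAt_fderiv_apply_time {y : V} {t : ℝ} (hF : ContDiffAt ℝ 2 F (y, t)) (m : V × ℝ) :
    HasDerivAt (fun s => fderiv ℝ F (y, s) m) (fderiv ℝ (fderiv ℝ F) (y, t) (0, 1) m) t := by
  have h := hasDerivAt_comp_prodMk (G := V × ℝ →L[ℝ] ℝ) (differentiableAt_fderiv hF)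
  simpa using h.clm_apply (hasDerivAt_const t m)

/-- The time derivative of the weighted energy density. -/
noncomputable def energyRate (b : OrthonormalBasis ι ℝ V) (F : V × ℝ → ℝ) (x₀ : V) (R : ℝ)
    (t : ℝ) (y : V) : ℝ :=
  -4 * conePart x₀ R (y, t) * (R - t) * energyDensity b (fderiv ℝ F (y, t)) +
    conePart x₀ R (y, t) ^ 2 * (fderiv ℝ F (y, t) (0, 1) *
      fderiv ℝ (fderiv ℝ F) (y, t) (0, 1) (0, 1) +
        ∑ i, fderiv ℝ F (y, t) (b i, 0) * fderiv ℝ (fderiv ℝ F) (y, t) (0, 1) (b i, 0))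

theorem hasDerivAt_weighted_energyDensity (b : OrthonormalBasis ι ℝ V) {y : V} {t : ℝ}
    (hF : ContDiffAt ℝ 2 F (y, t)) (x₀ : V) (R : ℝ) :
    HasDerivAt (fun s => conePart x₀ R (y, s) ^ 2 * energyDensity b (fderiv ℝ F (y, s)))
      (energyRate b F x₀ R t y) t := by
  have h1 : HasDerivAt (fun s => energyDensity b (fderiv ℝ F (y, s))) _ t :=
    (((hasDerivAt_fderiv_apply_time hF (0, 1)).pow 2).add
      (HasDerivAt.fun_sum (u := Finset.univ) fun i _ =>
        (hasDerivAt_fderiv_apply_time hF (b i, 0)).pow 2)).div_const 2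
  refine ((hasDerivAt_conePart_sq_time x₀ R y t).mul h1).congr_deriv ?_
  simp only [energyRate, Nat.cast_ofNat, mul_assoc, ← Finset.mul_sum, Nat.add_one_sub_one, pow_one]
  ring

variable [FiniteDimensional ℝ V] [MeasurableSpace V] [BorelSpace V]

theorem hasDerivAt_energy (b : OrthonormalBasis ι ℝ V)
    (hF : ContDiffOn ℝ 2 F (univ ×ˢ Ioi (0 : ℝ))) (x₀ : V) {R t : ℝ} (ht : t ∈ Ioo 0 R) :
    HasDerivAt (fun s => ∫ y, conePart x₀ R (y, s) ^ 2 * energyDensity b (fderiv ℝ F (y, s)))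
      (∫ y, energyRate b F x₀ R t y) t := by
  have hk := continuous_conePart x₀ R
  have he := continuous_energyDensity b
  have hsw : ∀ {G : Type _} [TopologicalSpace G] {H : V × ℝ → G},
      ContinuousOn H (univ ×ˢ Ioi (0 : ℝ)) →
      ContinuousOn (fun q : ℝ × V => H (q.2, q.1)) (Ioo 0 R ×ˢ univ) := fun hH =>
    hH.comp (f := fun q : ℝ × V => (q.2, q.1)) (by fun_prop) fun q hq => ⟨mem_univ _, hq.1.1⟩
  have h1 := hsw (continuousOn_fderiv_half hF)
  have h2 := hsw (continuousOn_fderiv_fderiv_half hF)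
  refine hasDerivAt_integral_of_compact_support isOpen_Ioo (isCompact_closedBall x₀ R)
    (fun s hs => ?_) ?_ (fun s hs y => ?_) (fun s hs y hy => ?_) ht
  · have := continuous_slice (continuousOn_fderiv_half hF) hs.1
    fun_prop
  · have h3 : ContinuousOn (fun q : ℝ × V => energyDensity b (fderiv ℝ F (q.2, q.1)))
      (Ioo 0 R ×ˢ univ) := he.comp_continuousOn h1
    simp only [Function.uncurry_def, energyRate]
    fun_prop
  · exact hasDerivAt_weighted_energyDensity b (contDiffAt_of_pos hF y hs.1) x₀ R
  · rw [conePart_eq_zero hs.1.le hs.2.le fun h => hy (Metric.ball_subset_closedBall h)]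
    simp

/-- By the wave equation and symmetry of the Hessian, the rate is a spatial divergence, which
integrates to zero, plus `4 * conePart` times the flux minus `(R - t)` times the energy density.
Where the weight is positive, `‖y - x₀‖ ≤ R - t`, so `flux_le_energyDensity` makes the second part
nonpositive. -/
theorem integral_energyRate_nonpos (b : OrthonormalBasis ι ℝ V)
    (hF : ContDiffOn ℝ 2 F (univ ×ˢ Ioi (0 : ℝ)))
    (hwave : ∀ y t, 0 < t → fderiv ℝ (fderiv ℝ F) (y, t) (0, 1) (0, 1) =
      ∑ i, fderiv ℝ (fderiv ℝ F) (y, t) (b i, 0) (b i, 0))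
    (x₀ : V) {R t : ℝ} (ht : t ∈ Ioo 0 R) : ∫ y, energyRate b F x₀ R t y ≤ 0 := by
  have hK := isCompact_closedBall x₀ R
  have hk0 : ∀ y ∉ Metric.closedBall x₀ R, conePart x₀ R (y, t) = 0 := fun y hy =>
    conePart_eq_zero ht.1.le ht.2.le fun h => hy (Metric.ball_subset_closedBall h)
  have hk : Continuous (fun y => conePart x₀ R (y, t)) :=
    (continuous_conePart x₀ R).comp (by fun_prop)
  have h1 := continuous_slice (continuousOn_fderiv_half hF) ht.1
  have h2 := continuous_slice (continuousOn_fderiv_fderiv_half hF) ht.1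
  have he : Continuous (fun y => energyDensity b (fderiv ℝ F (y, t))) :=
    (continuous_energyDensity b).comp h1
  have hC : ∀ y, ContDiffAt ℝ 2 F (y, t) := fun y => contDiffAt_of_pos hF y ht.1
  have hsymm : ∀ y v w, fderiv ℝ (fderiv ℝ F) (y, t) v w = fderiv ℝ (fderiv ℝ F) (y, t) w v :=
    fun y v w => ((hC y).isSymmSndFDerivAt (by simp)) v w
  -- integration by parts in each direction of the basis
  have hibp : ∀ i, ∫ y, (conePart x₀ R (y, t) ^ 2 * fderiv ℝ F (y, t) (b i, 0)) *
        fderiv ℝ (fderiv ℝ F) (y, t) (b i, 0) (0, 1) =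
      -∫ y, ((-4 * conePart x₀ R (y, t) * inner ℝ (y - x₀) (b i)) * fderiv ℝ F (y, t) (b i, 0) +
        conePart x₀ R (y, t) ^ 2 * fderiv ℝ (fderiv ℝ F) (y, t) (b i, 0) (b i, 0)) *
          fderiv ℝ F (y, t) (0, 1) := fun i => by
    refine integral_bilinear_hasLineDerivAt_right_eq_neg_left_of_integrable
      (B := ContinuousLinearMap.mul ℝ ℝ) (v := b i)
      (f := fun y => conePart x₀ R (y, t) ^ 2 * fderiv ℝ F (y, t) (b i, 0))
      (g := fun y => fderiv ℝ F (y, t) (0, 1)) ?_ ?_ ?_ (fun y _ => ?_) (fun y _ => ?_)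
    · exact integrable_of_eq_zero_off_compact hK
        (by simp only [ContinuousLinearMap.mul_apply']; fun_prop) fun y hy => by simp [hk0 y hy]
    · exact integrable_of_eq_zero_off_compact hK
        (by simp only [ContinuousLinearMap.mul_apply']; fun_prop) fun y hy => by simp [hk0 y hy]
    · exact integrable_of_eq_zero_off_compact hK
        (by simp only [ContinuousLinearMap.mul_apply']; fun_prop) fun y hy => by simp [hk0 y hy]
    · have := HasDerivAt.mul (hasLineDerivAt_conePart_sq x₀ R y (b i) t)
        (hasLineDerivAt_fderiv_apply (hC y) (b i) (b i, 0))
      exact HasDerivAt.congr_deriv this (by simp)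
    · exact hasLineDerivAt_fderiv_apply (hC y) (b i) (0, 1)
  have hrate : ∀ y, energyRate b F x₀ R t y =
      (4 * conePart x₀ R (y, t) * (fderiv ℝ F (y, t) (0, 1) *
        (∑ i, inner ℝ (y - x₀) (b i) * fderiv ℝ F (y, t) (b i, 0)) -
        (R - t) * energyDensity b (fderiv ℝ F (y, t)))) +
      ∑ i, ((conePart x₀ R (y, t) ^ 2 * fderiv ℝ F (y, t) (b i, 0)) *
        fderiv ℝ (fderiv ℝ F) (y, t) (b i, 0) (0, 1) +
      ((-4 * conePart x₀ R (y, t) * inner ℝ (y - x₀) (b i)) * fderiv ℝ F (y, t) (b i, 0) +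
        conePart x₀ R (y, t) ^ 2 * fderiv ℝ (fderiv ℝ F) (y, t) (b i, 0) (b i, 0)) *
          fderiv ℝ F (y, t) (0, 1)) := fun y => by
    simp only [energyRate, hwave y t ht.1, hsymm y (0, 1), mul_add, mul_sub, add_mul,
      Finset.mul_sum, Finset.sum_add_distrib]
    have e1 : ∑ i, 4 * conePart x₀ R (y, t) * (fderiv ℝ F (y, t) (0, 1) *
        (inner ℝ (y - x₀) (b i) * fderiv ℝ F (y, t) (b i, 0))) =
        -∑ i, -4 * conePart x₀ R (y, t) * inner ℝ (y - x₀) (b i) * fderiv ℝ F (y, t) (b i, 0) *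
          fderiv ℝ F (y, t) (0, 1) := by
      rw [← Finset.sum_neg_distrib]
      exact Finset.sum_congr rfl fun i _ => by ring
    have e2 : ∑ i, conePart x₀ R (y, t) ^ 2 * (fderiv ℝ F (y, t) (0, 1) *
        fderiv ℝ (fderiv ℝ F) (y, t) (b i, 0) (b i, 0)) =
        ∑ i, conePart x₀ R (y, t) ^ 2 * fderiv ℝ (fderiv ℝ F) (y, t) (b i, 0) (b i, 0) *
          fderiv ℝ F (y, t) (0, 1) :=
      Finset.sum_congr rfl fun i _ => by ring
    have e3 : ∑ i, conePart x₀ R (y, t) ^ 2 * (fderiv ℝ F (y, t) (b i, 0) *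
        fderiv ℝ (fderiv ℝ F) (y, t) (b i, 0) (0, 1)) =
        ∑ i, conePart x₀ R (y, t) ^ 2 * fderiv ℝ F (y, t) (b i, 0) *
          fderiv ℝ (fderiv ℝ F) (y, t) (b i, 0) (0, 1) :=
      Finset.sum_congr rfl fun i _ => by ring
    rw [e1, e2, e3]
    ring
  have hi1 : ∀ i, Integrable fun y => (conePart x₀ R (y, t) ^ 2 * fderiv ℝ F (y, t) (b i, 0)) *
        fderiv ℝ (fderiv ℝ F) (y, t) (b i, 0) (0, 1) := fun i =>
    integrable_of_eq_zero_off_compact hK (by fun_prop) fun y hy => by simp [hk0 y hy]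
  have hi2 : ∀ i, Integrable fun y =>
      ((-4 * conePart x₀ R (y, t) * inner ℝ (y - x₀) (b i)) * fderiv ℝ F (y, t) (b i, 0) +
        conePart x₀ R (y, t) ^ 2 * fderiv ℝ (fderiv ℝ F) (y, t) (b i, 0) (b i, 0)) *
          fderiv ℝ F (y, t) (0, 1) := fun i =>
    integrable_of_eq_zero_off_compact hK (by fun_prop) fun y hy => by simp [hk0 y hy]
  have hi3 : ∀ i, Integrable fun y =>
      (conePart x₀ R (y, t) ^ 2 * fderiv ℝ F (y, t) (b i, 0)) *
        fderiv ℝ (fderiv ℝ F) (y, t) (b i, 0) (0, 1) +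
      ((-4 * conePart x₀ R (y, t) * inner ℝ (y - x₀) (b i)) * fderiv ℝ F (y, t) (b i, 0) +
        conePart x₀ R (y, t) ^ 2 * fderiv ℝ (fderiv ℝ F) (y, t) (b i, 0) (b i, 0)) *
          fderiv ℝ F (y, t) (0, 1) := fun i => (hi1 i).add (hi2 i)
  simp only [hrate]
  rw [integral_add, integral_finsetSum _ fun i _ => hi3 i]
  · have : ∀ i, ∫ y, ((conePart x₀ R (y, t) ^ 2 * fderiv ℝ F (y, t) (b i, 0)) *
        fderiv ℝ (fderiv ℝ F) (y, t) (b i, 0) (0, 1) +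
      ((-4 * conePart x₀ R (y, t) * inner ℝ (y - x₀) (b i)) * fderiv ℝ F (y, t) (b i, 0) +
        conePart x₀ R (y, t) ^ 2 * fderiv ℝ (fderiv ℝ F) (y, t) (b i, 0) (b i, 0)) *
          fderiv ℝ F (y, t) (0, 1)) = 0 := fun i => by
      rw [integral_add (hi1 i) (hi2 i), hibp i]
      ring
    simp only [this, Finset.sum_const_zero, add_zero]
    refine integral_nonpos fun y => ?_
    rcases (conePart_nonneg x₀ R (y, t)).eq_or_lt with h | h
    · simp [← h]
    · have hlt : 0 < (R - t) ^ 2 - ‖y - x₀‖ ^ 2 := by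
        rcases lt_max_iff.1 h with h | h
        · exact h
        · exact absurd h (lt_irrefl _)
      have hz : ‖y - x₀‖ ≤ R - t := by
        have : 0 < R - t := sub_pos.2 ht.2
        nlinarith [norm_nonneg (y - x₀)]
      have := flux_le_energyDensity b (fderiv ℝ F (y, t)) (sub_pos.2 ht.2) hz
      exact mul_nonpos_of_nonneg_of_nonpos (by positivity) (by linarith)
  · exact integrable_of_eq_zero_off_compact hK (by fun_prop) fun y hy => by simp [hk0 y hy]
  · exact integrable_finsetSum _ fun i _ => hi3 i

end Energy

/-! ### Finite propagation speed. -/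

section DomainOfDependence

variable {V : Type*} [NormedAddCommGroup V] [InnerProductSpace ℝ V] {ι : Type*} [Fintype ι]
  [FiniteDimensional ℝ V] [MeasurableSpace V] [BorelSpace V] {F : V × ℝ → ℝ}

/-- A wave whose Cauchy data vanish on a ball vanishes in the light cone over that ball. -/
theorem eq_zero_in_lightCone (b : OrthonormalBasis ι ℝ V)
    (hF : ContDiffOn ℝ 2 F (univ ×ˢ Ioi (0 : ℝ))) (hF1 : ContDiffOn ℝ 1 F (univ ×ˢ Ici (0 : ℝ)))
    (hwave : ∀ y t, 0 < t → fderiv ℝ (fderiv ℝ F) (y, t) (0, 1) (0, 1) =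
      ∑ i, fderiv ℝ (fderiv ℝ F) (y, t) (b i, 0) (b i, 0))
    {x₀ : V} {R : ℝ} (hval : ∀ y ∈ Metric.ball x₀ R, F (y, 0) = 0)
    (hvel : ∀ y ∈ Metric.ball x₀ R, derivWithin (fun t => F (y, t)) (Ici 0) 0 = 0)
    {y : V} {t : ℝ} (ht : 0 ≤ t) (hy : ‖y - x₀‖ < R - t) : F (y, t) = 0 := by
  set H : Set (V × ℝ) := univ ×ˢ Ici (0 : ℝ) with hH
  have huniq : UniqueDiffOn ℝ H := uniqueDiffOn_univ.prod (uniqueDiffOn_Ici 0)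
  have hdiff : DifferentiableOn ℝ F H := hF1.differentiableOn (by simp)
  have hD : ContinuousOn (fderivWithin ℝ F H) H := hF1.continuousOn_fderivWithin huniq le_rfl
  have hDpos : ∀ y s, 0 < s → fderivWithin ℝ F H (y, s) = fderiv ℝ F (y, s) := fun y s hs =>
    fderivWithin_of_mem_nhds (prod_mem_nhds Filter.univ_mem (Ici_mem_nhds hs))
  have hDt : ∀ y s, 0 ≤ s →
      HasDerivWithinAt (fun s => F (y, s)) (fderivWithin ℝ F H (y, s) (0, 1)) (Ici 0) s := by
    intro y s hs
    have h1 := (hdiff (y, s) ⟨mem_univ y, hs⟩).hasFDerivWithinAt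
    exact h1.comp_hasDerivWithinAt (f := fun s => (y, s)) s
      ((hasDerivAt_const s y).prodMk (hasDerivAt_id s)).hasDerivWithinAt
      fun s hs => ⟨mem_univ y, hs⟩
  have hDt0 : ∀ y ∈ Metric.ball x₀ R, fderivWithin ℝ F H (y, 0) (0, 1) = 0 := fun y hy => by
    rw [← (hDt y 0 le_rfl).derivWithin (uniqueDiffWithinAt_Ici 0), hvel y hy]
  have hDx0 : ∀ y ∈ Metric.ball x₀ R, ∀ e : V, fderivWithin ℝ F H (y, 0) (e, 0) = 0 := by
    intro y hy e
    have h1 := (hdiff (y, 0) ⟨mem_univ y, self_mem_Ici⟩).hasFDerivWithinAt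
    have h2 : HasFDerivAt (fun z => F (z, 0))
        ((fderivWithin ℝ F H (y, 0)).comp (.inl ℝ V ℝ)) y := by
      rw [← hasFDerivWithinAt_univ]
      exact h1.comp (f := fun z => (z, (0 : ℝ))) y (hasFDerivAt_prodMk_left y 0).hasFDerivWithinAt
        fun z _ => ⟨mem_univ z, self_mem_Ici⟩
    have h3 : (fun z => F (z, 0)) =ᶠ[nhds y] fun _ => 0 := by
      filter_upwards [Metric.isOpen_ball.mem_nhds hy] with z hz using hval z hz
    have h4 := h2.unique ((hasFDerivAt_const (0 : ℝ) y).congr_of_eventuallyEq h3)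
    simpa using congrArg (fun A => A e) h4
  -- The one-sided derivative `fderivWithin` makes the energy meaningful and continuous down to time
  -- `0`, where only `C¹` regularity is available; for positive times it is the ordinary derivative.
  set E : ℝ → ℝ := fun s =>
    ∫ y, conePart x₀ R (y, s) ^ 2 * energyDensity b (fderivWithin ℝ F H (y, s)) with hE
  have hEd : ∀ s ∈ Ioo 0 R, HasDerivAt E (∫ y, energyRate b F x₀ R s y) s := fun s hs => by
    refine (hasDerivAt_energy b hF x₀ hs).congr_of_eventuallyEq ?_
    filter_upwards [Ioi_mem_nhds hs.1] with r hr
    simp only [hE, hDpos _ r hr]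
  have hEc : ContinuousOn E (Ico 0 R) := by
    refine continuousOn_integral_of_compact_support (isCompact_closedBall x₀ R) ?_ ?_
    · have h1 : ContinuousOn (fun q : ℝ × V => fderivWithin ℝ F H (q.2, q.1)) (Ico 0 R ×ˢ univ) :=
        hD.comp (f := fun q : ℝ × V => (q.2, q.1)) (by fun_prop)
          fun q hq => ⟨mem_univ _, hq.1.1⟩
      have h2 : ContinuousOn (fun q : ℝ × V => energyDensity b (fderivWithin ℝ F H (q.2, q.1)))
        (Ico 0 R ×ˢ univ) := (continuous_energyDensity b).comp_continuousOn h1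
      have h3 := continuous_conePart x₀ R
      simp only [Function.uncurry_def]
      fun_prop
    · intro s y hs hy
      rw [conePart_eq_zero hs.1 hs.2.le fun h => hy (Metric.ball_subset_closedBall h)]
      simp
  have hEanti : AntitoneOn E (Ico 0 R) := by
    refine antitoneOn_of_deriv_nonpos (convex_Ico 0 R) hEc ?_ ?_ <;> rw [interior_Ico]
    · exact fun s hs => (hEd s hs).differentiableAt.differentiableWithinAt
    · intro s hs
      rw [(hEd s hs).deriv]
      exact integral_energyRate_nonpos b hF hwave x₀ hs
  have hR : 0 < R := by linarith [norm_nonneg (y - x₀)]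
  have hE0 : E 0 = 0 := by
    refine integral_eq_zero_of_ae (Filter.Eventually.of_forall fun y => ?_)
    by_cases hy : y ∈ Metric.ball x₀ R
    · simp [energyDensity, hDt0 y hy, hDx0 y hy]
    · simp [conePart_eq_zero le_rfl hR.le hy]
  have hkey : ∀ s ∈ Ioo 0 R, ∀ z, ‖z - x₀‖ < R - s → fderiv ℝ F (z, s) (0, 1) = 0 := by
    intro s hs z hz
    have h1 : E s ≤ 0 := hE0 ▸ hEanti ⟨le_rfl, hR⟩ ⟨hs.1.le, hs.2⟩ hs.1.le
    have hnn : ∀ y, 0 ≤ conePart x₀ R (y, s) ^ 2 * energyDensity b (fderiv ℝ F (y, s)) :=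
      fun y => mul_nonneg (sq_nonneg _) (energyDensity_nonneg b _)
    have hc : Continuous
        (fun y => conePart x₀ R (y, s) ^ 2 * energyDensity b (fderiv ℝ F (y, s))) := by
      have h2 := continuous_slice (continuousOn_fderiv_half hF) hs.1
      have h3 := continuous_conePart x₀ R
      have h4 := continuous_energyDensity b
      fun_prop
    have hi := integrable_of_eq_zero_off_compact (μ := volume) (isCompact_closedBall x₀ R) hc
      fun y hy => by
        rw [conePart_eq_zero hs.1.le hs.2.le fun h => hy (Metric.ball_subset_closedBall h)]
        simp
    have h5 : ∫ y, conePart x₀ R (y, s) ^ 2 * energyDensity b (fderiv ℝ F (y, s)) = 0 := by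
      refine le_antisymm ?_ (integral_nonneg hnn)
      simpa only [hE, hDpos _ s hs.1] using h1
    -- Zero energy kills the continuous nonnegative density everywhere, not just almost everywhere;
    -- the weight is positive inside the cone, so the time derivative vanishes there.
    have h6 := (hc.ae_eq_iff_eq volume continuous_const).1
      ((integral_eq_zero_iff_of_nonneg hnn hi).1 h5)
    have h7 := congrFun h6 z
    have h8 : conePart x₀ R (z, s) ^ 2 ≠ 0 := (pow_pos (conePart_pos hz) 2).ne'
    have h9 : energyDensity b (fderiv ℝ F (z, s)) = 0 := (mul_eq_zero.1 h7).resolve_left h8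
    rw [energyDensity] at h9
    have h10 : 0 ≤ ∑ i, fderiv ℝ F (z, s) (b i, 0) ^ 2 := by positivity
    exact pow_eq_zero_iff two_ne_zero |>.1 (le_antisymm (by linarith) (sq_nonneg _))
  have hyb : y ∈ Metric.ball x₀ R := by
    rw [mem_ball_iff_norm]
    linarith
  rw [← hval y hyb]
  -- The vertical segment from `(y, 0)` to `(y, t)` stays in the cone, so the vanishing time
  -- derivative alone suffices.
  refine constant_of_has_deriv_right_zero (f := fun s => F (y, s)) (a := 0) (b := t) ?_ ?_ t
    ⟨ht, le_rfl⟩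
  · exact fun s hs => ((hDt y s hs.1).mono Icc_subset_Ici_self).continuousWithinAt
  · intro s hs
    refine ((hDt y s hs.1).mono (Ici_subset_Ici.2 hs.1)).congr_deriv ?_
    rcases hs.1.eq_or_lt with rfl | h0
    · exact hDt0 y hyb
    · rw [hDpos y s h0]
      exact hkey s ⟨h0, by linarith [hs.2, norm_nonneg (y - x₀)]⟩ y (by linarith [hs.2])

end DomainOfDependence

/-! ### Linearity and uniqueness for classical solutions. -/

section IsWaveSolution

variable {n : ℕ} {f g f' g' : EuclideanSpace ℝ (Fin n) → ℝ} {u u' : EuclideanSpace ℝ (Fin n) → ℝ → ℝ}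

theorem IsWaveSolution.contDiffAt (hu : IsWaveSolution f g u) (x : EuclideanSpace ℝ (Fin n))
    {t : ℝ} (ht : 0 < t) :
    ContDiffAt ℝ 2 (fun p : EuclideanSpace ℝ (Fin n) × ℝ => u p.1 p.2) (x, t) :=
  contDiffAt_of_pos hu.contDiffOn_two x ht

theorem IsWaveSolution.differentiableWithinAt_zero (hu : IsWaveSolution f g u)
    (x : EuclideanSpace ℝ (Fin n)) : DifferentiableWithinAt ℝ (u x) (Ici 0) 0 := by
  have h := hu.contDiffOn_one.differentiableOn (by simp) (x, 0) ⟨mem_univ x, self_mem_Ici⟩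
  exact h.comp (f := fun s : ℝ => (x, s)) 0 (by fun_prop) fun s hs => ⟨mem_univ x, hs⟩

theorem IsWaveSolution.contDiffAt_time (hu : IsWaveSolution f g u)
    (x : EuclideanSpace ℝ (Fin n)) {t : ℝ} (ht : 0 < t) : ContDiffAt ℝ 2 (u x) t :=
  (hu.contDiffAt x ht).comp (f := fun s : ℝ => (x, s)) t (by fun_prop)

theorem IsWaveSolution.contDiffAt_space (hu : IsWaveSolution f g u)
    (x : EuclideanSpace ℝ (Fin n)) {t : ℝ} (ht : 0 < t) : ContDiffAt ℝ 2 (fun y => u y t) x :=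
  (hu.contDiffAt x ht).comp (f := fun y : EuclideanSpace ℝ (Fin n) => (y, t)) x (by fun_prop)

theorem IsWaveSolution.sub (hu : IsWaveSolution f g u) (hu' : IsWaveSolution f' g' u') :
    IsWaveSolution (fun x => f x - f' x) (fun x => g x - g' x) (fun x t => u x t - u' x t) where
  contDiffOn_two := hu.contDiffOn_two.sub hu'.contDiffOn_two
  contDiffOn_one := hu.contDiffOn_one.sub hu'.contDiffOn_one
  wave_eq x t ht := by
    have e1 : iteratedDeriv 2 (fun s => u x s - u' x s) t =
        iteratedDeriv 2 (u x) t - iteratedDeriv 2 (u' x) t :=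
      iteratedDeriv_fun_sub (hu.contDiffAt_time x ht) (hu'.contDiffAt_time x ht)
    have e2 : Δ (fun y => u y t - u' y t) x = Δ (fun y => u y t) x - Δ (fun y => u' y t) x :=
      (hu.contDiffAt_space x ht).laplacian_sub (hu'.contDiffAt_space x ht)
    rw [e1, e2]
    linear_combination hu.wave_eq x t ht - hu'.wave_eq x t ht
  initial_value x := by rw [hu.initial_value, hu'.initial_value]
  initial_velocity x := by
    rw [← hu.initial_velocity, ← hu'.initial_velocity]
    exact derivWithin_fun_sub (hu.differentiableWithinAt_zero x) (hu'.differentiableWithinAt_zero x)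

theorem IsWaveSolution.eq_zero_in_lightCone (hu : IsWaveSolution f g u)
    {x₀ : EuclideanSpace ℝ (Fin n)} {R : ℝ} (hf : ∀ y ∈ Metric.ball x₀ R, f y = 0)
    (hg : ∀ y ∈ Metric.ball x₀ R, g y = 0) {y : EuclideanSpace ℝ (Fin n)} {t : ℝ} (ht : 0 ≤ t)
    (hy : ‖y - x₀‖ < R - t) : u y t = 0 := by
  refine WaveAbel.eq_zero_in_lightCone (EuclideanSpace.basisFun (Fin n) ℝ)
    (F := fun p => u p.1 p.2) hu.contDiffOn_two
    hu.contDiffOn_one (fun x s hs => ?_) (x₀ := x₀) (R := R)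
    (fun z hz => (hu.initial_value z).trans (hf z hz))
    (fun z hz => (hu.initial_velocity z).trans (hg z hz)) ht hy
  have h := hu.wave_eq x s hs
  have e1 := iteratedDeriv_two_comp_prodMk (hu.contDiffAt x hs)
  have e2 := laplacian_comp_prodMk (hu.contDiffAt x hs) (EuclideanSpace.basisFun (Fin n) ℝ)
  simp only [iteratedFDeriv_two_apply, Matrix.cons_val_zero, Matrix.cons_val_one] at e1 e2
  rw [← e1, ← e2]
  exact sub_eq_zero.1 h

/-- The difference has zero data everywhere, so any cone over `x` taller than `t` works; `R = t + 1`
is one. -/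
theorem IsWaveSolution.unique (hu : IsWaveSolution f g u) (hu' : IsWaveSolution f g u')
    (x : EuclideanSpace ℝ (Fin n)) {t : ℝ} (ht : 0 ≤ t) : u x t = u' x t :=
  sub_eq_zero.1 ((hu.sub hu').eq_zero_in_lightCone (x₀ := x) (R := t + 1) (fun _ _ => sub_self _)
    (fun _ _ => sub_self _) ht (by simp))

end IsWaveSolution

/-! ### Combining the averaging formula with the Abel calculus. -/

/-- The Abel-type identities between a smooth profile `h` vanishing near the origin and its
average `N`. -/
theorem abel_identities {m : ℕ} {h U N : ℝ → ℝ} (hh : ContDiff ℝ ∞ h) (h0 : h =ᶠ[nhds 0] 0)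
    (hU : EqOn U h (Ioi 0))
    (hN : ∀ r, 0 < r → N r = (∫ θ in (0 : ℝ)..(π / 2), cos θ ^ (2 * m))⁻¹ *
      ∫ θ in (0 : ℝ)..(π / 2), h (r * sin θ) * cos θ ^ (2 * m)) {r : ℝ} (hr : 0 < r) :
    (IntervalIntegrable (fun t => U t / √(r ^ 2 - t ^ 2)) volume 0 r ∧
      (invMulDeriv^[m]) (fun s => s ^ (2 * m) * N s) r =
        2 * ((2 * m + 2)‼ : ℕ) / (π * (2 * m + 2 : ℕ)) *
          ∫ t in (0 : ℝ)..r, U t / √(r ^ 2 - t ^ 2)) ∧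
    (IntervalIntegrable (fun t => (derivInvMul^[m]) U t / √(r ^ 2 - t ^ 2)) volume 0 r ∧
      (invMulDeriv^[2 * m]) (fun s => s ^ (2 * m) * N s) r =
        2 * ((2 * m + 2)‼ : ℕ) / (π * (2 * m + 2 : ℕ)) *
          ∫ t in (0 : ℝ)..r, (derivInvMul^[m]) U t / √(r ^ 2 - t ^ 2)) := by
  set J := ∫ θ in (0 : ℝ)..(π / 2), cos θ ^ (2 * m) with hJ
  have hJ0 : J ≠ 0 := (integral_cos_pow_even_pos m).ne'
  -- The constant is the product `(2m-1)‼` of the odd factors from `m` derivatives, divided by the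
  -- total mass `J` of the weight; Wallis' formula evaluates `J`.
  have hconst : 2 * ((2 * m + 2)‼ : ℕ) / (π * (2 * m + 2 : ℕ)) = J⁻¹ * ((2 * m - 1)‼ : ℕ) := by
    have hc := integral_cos_pow_even_mul m
    have hπ := pi_pos.ne'
    have h2 : (2 * m + 2 : ℝ) ≠ 0 := by positivity
    rw [Nat.doubleFactorial_add_two]
    push_cast
    rw [inv_mul_eq_div, div_eq_div_iff (by positivity) hJ0]
    linear_combination 2 * (2 * m + 2 : ℝ) * hc
  have hsing : ∀ {A B : ℝ → ℝ}, EqOn A B (Ioi 0) → Continuous B →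
      IntervalIntegrable (fun t => A t / √(r ^ 2 - t ^ 2)) volume 0 r ∧
        ∫ t in (0 : ℝ)..r, A t / √(r ^ 2 - t ^ 2) = abelMean 0 B r := by
    intro A B hAB hB
    obtain ⟨h1, h2⟩ := integral_div_sqrt_eq_abelMean hB hr
    have h3 : EqOn (fun t => B t / √(r ^ 2 - t ^ 2)) (fun t => A t / √(r ^ 2 - t ^ 2))
        (Ioc 0 r) := fun t ht => by simp only [hAB ht.1]
    refine ⟨h1.congr (by rwa [uIoc_of_le hr.le]), ?_⟩
    rw [← h2, intervalIntegral.integral_of_le hr.le, intervalIntegral.integral_of_le hr.le]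
    exact (setIntegral_congr_fun measurableSet_Ioc h3).symm
  have hstep : EqOn (invMulDeriv^[m] (fun s => s ^ (2 * m) * N s))
      (fun s => J⁻¹ * ((2 * m - 1)‼ : ℕ) * abelMean 0 h s) (Ioi 0) := by
    intro s hs
    have h1 : EqOn (fun s => s ^ (2 * m) * N s) (fun s => J⁻¹ * abelMean m h s) (Ioi 0) := by
      intro s hs
      simp only [hN s hs, abelMean]
      ring
    rw [iterate_invMulDeriv_congr h1 m hs, iterate_invMulDeriv_const_mul]
    simp only [iterate_invMulDeriv_abelMean hh m hs]
    ring
  obtain ⟨hI1, hv1⟩ := hsing hU hh.continuous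
  obtain ⟨hI2, hv2⟩ := hsing (iterate_derivInvMul_congr hU m)
    (contDiff_iterate_derivInvMul hh h0 m).continuous
  refine ⟨⟨hI1, ?_⟩, hI2, ?_⟩
  · rw [hstep hr, hconst, hv1]
  -- The first `m` derivatives use up the weight `cos ^ (2m)`; the remaining `m` act on `abelMean 0
  -- h` and move inside the integral.
  · rw [two_mul m, Function.iterate_add_apply, ← two_mul m, iterate_invMulDeriv_congr hstep m hr,
      iterate_invMulDeriv_const_mul]
    simp only [iterate_invMulDeriv_abelMean_zero hh h0 m hr]
    rw [hconst, hv2]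

theorem contDiffOn_of_eq_average {m : ℕ} {h N : ℝ → ℝ} {c : ℝ} (hh : ContDiff ℝ ∞ h)
    (hN : ∀ r, 0 < r → N r = c * ∫ θ in (0 : ℝ)..(π / 2), h (r * sin θ) * cos θ ^ (2 * m)) :
    ContDiffOn ℝ ∞ N (Ioi 0) := by
  refine ContDiffOn.congr ?_ fun r hr => hN r hr
  exact (contDiff_const.mul (contDiff_integral_comp_mul_sin hh
    (w := fun θ => cos θ ^ (2 * m)) (by fun_prop) 0 (π / 2))).contDiffOn

theorem hasLineDerivAt_of_contDiff {V : Type*} [NormedAddCommGroup V] [NormedSpace ℝ V]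
    {w : V × ℝ → ℝ} (hw : ContDiff ℝ ∞ w) (x v : V) (t : ℝ) :
    HasLineDerivAt ℝ (fun y => w (y, t)) (fderiv ℝ w (x, t) (v, 0)) x v := by
  simpa using (hasFDerivAt_comp_prodMk_left
    ((hw.differentiable (by simp)).differentiableAt (x := (x, t)))).hasLineDerivAt v

theorem hasLineDerivAt_integral_comp_mul_sin {V : Type*} [NormedAddCommGroup V] [NormedSpace ℝ V]
    {w : V × ℝ → ℝ} (hw : ContDiff ℝ ∞ w) {c : ℝ → ℝ} (hc : Continuous c) (x v : V)
    (a b r : ℝ) :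
    HasLineDerivAt ℝ (fun y => ∫ θ in a..b, w (y, r * sin θ) * c θ)
      (∫ θ in a..b, fderiv ℝ w (x, r * sin θ) (v, 0) * c θ) x v := by
  have hd : Continuous (fderiv ℝ w) := hw.continuous_fderiv (by simp)
  have hwc := hw.continuous
  have hc' : Continuous (fun p : ℝ × ℝ =>
      fderiv ℝ w (x + p.1 • v, r * sin p.2) (v, 0) * c p.2) := by fun_prop
  obtain ⟨C, hC⟩ := ((isCompact_closedBall (0 : ℝ) 1).prod
    (isCompact_uIcc (a := a) (b := b))).exists_bound_of_continuousOn hc'.continuousOn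
  have key := (intervalIntegral.hasDerivAt_integral_of_dominated_loc_of_deriv_le (μ := volume)
    (F := fun s θ => w (x + s • v, r * sin θ) * c θ) (bound := fun _ => C) (a := a) (b := b)
    (F' := fun s θ => fderiv ℝ w (x + s • v, r * sin θ) (v, 0) * c θ)
    (Metric.ball_mem_nhds (0 : ℝ) one_pos) (Filter.Eventually.of_forall fun s => ?_) ?_ ?_ ?_ ?_
    ?_).2
  · simpa [HasLineDerivAt] using key
  · exact Continuous.aestronglyMeasurable (by fun_prop)
  · exact Continuous.intervalIntegrable (by fun_prop) _ _
  · exact Continuous.aestronglyMeasurable (by fun_prop)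
  · refine Filter.Eventually.of_forall fun θ hθ s hs => ?_
    exact hC (s, θ) ⟨Metric.ball_subset_closedBall hs, uIoc_subset_uIcc hθ⟩
  · exact intervalIntegrable_const
  · refine Filter.Eventually.of_forall fun θ _ s _ => ?_
    have h1 : HasDerivAt (fun s : ℝ => (x + s • v, r * sin θ)) (v, 0) s := by
      refine HasDerivAt.prodMk ?_ (hasDerivAt_const _ _)
      simpa using ((hasDerivAt_id s).smul_const v).const_add x
    have h2 := ((hw.differentiable (by simp)).differentiableAt
      (x := (x + s • v, r * sin θ))).hasFDerivAt
    exact (h2.comp_hasDerivAt s h1).mul_const (c θ)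

end WaveAbel

/-! ### The two profiles at a boundary point. -/

theorem mainTheorem8 (n : ℕ) (hn : 2 ≤ n) (hn_even : Even n)
    (Ω : Set (EuclideanSpace ℝ (Fin n))) (hΩ : IsOpen Ω)
    (f : EuclideanSpace ℝ (Fin n) → ℝ) (hf_smooth : ContDiff ℝ ∞ f)
    (hf_compact : HasCompactSupport f) (hf_supp : tsupport f ⊆ Ω)
    (u : EuclideanSpace ℝ (Fin n) → ℝ → ℝ) (hu : WaveAbel.IsWaveSolution f (fun _ => 0) u)
    (x : EuclideanSpace ℝ (Fin n)) (hx : x ∈ frontier Ω) (v : EuclideanSpace ℝ (Fin n)) :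
    -- all derivatives that occur below exist
    (ContDiffOn ℝ ∞ (WaveAbel.sphericalMean f x) (Ioi 0) ∧
      (∀ r, 0 < r → LineDifferentiableAt ℝ (fun y => WaveAbel.sphericalMean f y r) x v) ∧
      ContDiffOn ℝ ∞ (WaveAbel.spatialDeriv v (WaveAbel.sphericalMean f) x) (Ioi 0) ∧
      ContDiffOn ℝ ∞ (u x) (Ioi 0) ∧
      (∀ t, 0 < t → LineDifferentiableAt ℝ (fun y => u y t) x v) ∧
      ContDiffOn ℝ ∞ (WaveAbel.spatialDeriv v u x) (Ioi 0)) ∧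
    ∀ r : ℝ, 0 < r →
      (IntervalIntegrable (fun t => u x t / √(r ^ 2 - t ^ 2)) volume 0 r ∧
        (WaveAbel.invMulDeriv^[(n - 2) / 2])
            (fun s => s ^ (n - 2) * WaveAbel.sphericalMean f x s) r =
          2 * (n‼ : ℝ) / (Real.pi * n) * ∫ t in (0 : ℝ)..r, u x t / √(r ^ 2 - t ^ 2)) ∧
      (IntervalIntegrable (fun t => WaveAbel.spatialDeriv v u x t / √(r ^ 2 - t ^ 2)) volume 0 r ∧
        (WaveAbel.invMulDeriv^[(n - 2) / 2])
            (fun s => s ^ (n - 2) * WaveAbel.spatialDeriv v (WaveAbel.sphericalMean f) x s) r =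
          2 * (n‼ : ℝ) / (Real.pi * n) *
            ∫ t in (0 : ℝ)..r, WaveAbel.spatialDeriv v u x t / √(r ^ 2 - t ^ 2)) ∧
      (IntervalIntegrable
          (fun t => (WaveAbel.derivInvMul^[(n - 2) / 2]) (u x) t / √(r ^ 2 - t ^ 2)) volume 0 r ∧
        (WaveAbel.invMulDeriv^[n - 2])
            (fun s => s ^ (n - 2) * WaveAbel.sphericalMean f x s) r =
          2 * (n‼ : ℝ) / (Real.pi * n) *
            ∫ t in (0 : ℝ)..r,
              (WaveAbel.derivInvMul^[(n - 2) / 2]) (u x) t / √(r ^ 2 - t ^ 2)) ∧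
      (IntervalIntegrable
          (fun t => (WaveAbel.derivInvMul^[(n - 2) / 2]) (WaveAbel.spatialDeriv v u x) t /
            √(r ^ 2 - t ^ 2)) volume 0 r ∧
        (WaveAbel.invMulDeriv^[n - 2])
            (fun s => s ^ (n - 2) * WaveAbel.spatialDeriv v (WaveAbel.sphericalMean f) x s) r =
          2 * (n‼ : ℝ) / (Real.pi * n) *
            ∫ t in (0 : ℝ)..r,
              (WaveAbel.derivInvMul^[(n - 2) / 2]) (WaveAbel.spatialDeriv v u x) t /
                √(r ^ 2 - t ^ 2)) := by

  obtain ⟨k, hk⟩ := hn_even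
  obtain ⟨m, rfl⟩ : ∃ m, n = 2 * m + 2 := ⟨k - 1, by omega⟩
  obtain ⟨w, hw, hwsol, hweven, hmean⟩ := WaveAbel.exists_smooth_wave rfl hf_smooth hf_compact
  have huw : ∀ y t, 0 ≤ t → u y t = w (y, t) := fun y t ht => hu.unique hwsol y ht
  -- the initial datum vanishes near the boundary point, hence so does the wave
  have hxΩ : x ∉ Ω := fun h => by
    rw [hΩ.frontier_eq] at hx
    exact hx.2 h
  obtain ⟨R, hR, hball⟩ := Metric.isOpen_iff.1 (isClosed_tsupport f).isOpen_compl x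
    fun h => hxΩ (hf_supp h)
  have hfzero : ∀ y ∈ Metric.ball x R, f y = 0 := fun y hy => image_eq_zero_of_notMem_tsupport
    (hball hy)
  -- Evenness extends the vanishing to negative times: the profiles have to be zero on a two-sided
  -- neighbourhood of `0`.
  have hwcone : ∀ y t, ‖y - x‖ < R - |t| → w (y, t) = 0 := fun y t hy => by
    have h := hwsol.eq_zero_in_lightCone hfzero (fun _ _ => rfl) (abs_nonneg t) hy
    rcases abs_choice t with ht | ht
    · rwa [ht] at h
    · rwa [ht, hweven] at h
  set h₁ : ℝ → ℝ := fun t => w (x, t) with hh₁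
  set h₂ : ℝ → ℝ := fun t => fderiv ℝ w (x, t) (v, 0) with hh₂
  have hh₁s : ContDiff ℝ ∞ h₁ := hw.comp (contDiff_prodMk_right x)
  have hh₂s : ContDiff ℝ ∞ h₂ :=
    ((hw.fderiv_right (m := ∞) (by simp)).comp (contDiff_prodMk_right x)).clm_apply contDiff_const
  have hnear : ∀ᶠ t in nhds (0 : ℝ), |t| < R := by
    filter_upwards [Metric.ball_mem_nhds (0 : ℝ) hR] with t ht
    simpa using ht
  have hh₁0 : h₁ =ᶠ[nhds 0] 0 := by
    filter_upwards [hnear] with t ht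
    exact hwcone x t (by simpa using ht)
  have hh₂0 : h₂ =ᶠ[nhds 0] 0 := by
    filter_upwards [hnear] with t ht
    have hopen : IsOpen {p : EuclideanSpace ℝ (Fin (2 * m + 2)) × ℝ | ‖p.1 - x‖ < R - |p.2|} :=
      isOpen_lt (by fun_prop) (by fun_prop)
    -- The double cone is open, so `w` vanishes near `(x, t)` in space-time and its spatial
    -- derivative is zero there too.
    have hz : w =ᶠ[nhds (x, t)] fun _ => 0 := by
      filter_upwards [hopen.mem_nhds (show (x, t) ∈ _ by simpa using ht)] with p hp
        using hwcone p.1 p.2 hp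
    simp [hh₂, hz.fderiv_eq]
  set c := (∫ θ in (0 : ℝ)..(Real.pi / 2), Real.cos θ ^ (2 * m))⁻¹ with hc
  have hN₁ : ∀ r, 0 < r → WaveAbel.sphericalMean f x r =
      c * ∫ θ in (0 : ℝ)..(Real.pi / 2), h₁ (r * Real.sin θ) * Real.cos θ ^ (2 * m) :=
    fun r hr => hmean x r hr.le
  have hline : ∀ r, 0 < r → HasLineDerivAt ℝ (fun y => WaveAbel.sphericalMean f y r)
      (c * ∫ θ in (0 : ℝ)..(Real.pi / 2), h₂ (r * Real.sin θ) * Real.cos θ ^ (2 * m)) x v := by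
    intro r hr
    have h := WaveAbel.hasLineDerivAt_integral_comp_mul_sin hw
      (c := fun θ => Real.cos θ ^ (2 * m)) (by fun_prop) x v 0 (Real.pi / 2) r
    have e : (fun y => WaveAbel.sphericalMean f y r) = fun y =>
        c * ∫ θ in (0 : ℝ)..(Real.pi / 2), w (y, r * Real.sin θ) * Real.cos θ ^ (2 * m) :=
      funext fun y => hmean y r hr.le
    rw [e]
    exact HasDerivAt.const_mul c h
  have hN₂ : ∀ r, 0 < r → WaveAbel.spatialDeriv v (WaveAbel.sphericalMean f) x r =
      c * ∫ θ in (0 : ℝ)..(Real.pi / 2), h₂ (r * Real.sin θ) * Real.cos θ ^ (2 * m) :=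
    fun r hr => (hline r hr).lineDeriv
  have hU₁ : EqOn (u x) h₁ (Ioi 0) := fun t ht => huw x t (le_of_lt ht)
  have hlineu : ∀ t, 0 < t → HasLineDerivAt ℝ (fun y => u y t) (h₂ t) x v := by
    intro t ht
    have e : (fun y => u y t) = fun y => w (y, t) := funext fun y => huw y t ht.le
    rw [e]
    exact WaveAbel.hasLineDerivAt_of_contDiff hw x v t
  have hU₂ : EqOn (WaveAbel.spatialDeriv v u x) h₂ (Ioi 0) := fun t ht => (hlineu t ht).lineDeriv
  refine ⟨⟨WaveAbel.contDiffOn_of_eq_average hh₁s hN₁,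
    fun r hr => (hline r hr).lineDifferentiableAt,
    WaveAbel.contDiffOn_of_eq_average hh₂s hN₂, hh₁s.contDiffOn.congr hU₁,
    fun t ht => (hlineu t ht).lineDifferentiableAt, hh₂s.contDiffOn.congr hU₂⟩, fun r hr => ?_⟩
  obtain ⟨a₁, a₂⟩ := WaveAbel.abel_identities hh₁s hh₁0 hU₁ hN₁ hr
  obtain ⟨b₁, b₂⟩ := WaveAbel.abel_identities hh₂s hh₂0 hU₂ hN₂ hr
  rw [show 2 * m + 2 - 2 = 2 * m by omega, show 2 * m / 2 = m by omega]
  exact ⟨a₁, b₁, a₂, b₂⟩
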